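/- Let $k$ be a field and let $A$ be a finite dimensional (associative, unital) $k$-algebra. Write $A\text{-mod}$ for the category of finitely generated left $A$-modules, $\mathrm{proj}\,A$ for its full subcategory of projective modules, and $\nu_A=\mathrm{D}\,\mathrm{Hom}_A(-,A)$, with $\mathrm{D}=\mathrm{Hom}_k(-,k)$, for the Nakayama functor on $A\text{-mod}$. A finitely generated projective module $P$ is called strongly projective-injective if $\nu_A^i(P)$ is projective for all $i>0$; let $\mathrm{stp}(A)$ be the full subcategory of $\mathrm{proj}\,A$ of these modules. The $\nu$-dominant dimension of $A$ is the largest $d\in\{0,1,2,\dots\}\cup\{\infty\}$ such that in a minimal injective resolution $0\to {}_AA\to I^0\to I^1\to\cdots$ of the left regular module, $I^i$ is strongly projective-injective for all $i<d$. Let $K^b(-)$ denote the bounded homotopy category of an additive category, $D^b(A)$ the bounded derived category of $A\text{-mod}$, and regard $K^b(\mathrm{stp}(A))$ as a full subcategory of $K^b(\mathrm{proj}\,A)$, closed under isomorphisms. For $P\in K^b(\mathrm{proj}\,A)$ let $\nu_A(P)$ be the complex obtained by applying $\nu_A$ componentwise, and put $$\mathcal{X}_A=\{P\in K^b(\mathrm{proj}\,A)\mid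 P\cong \nu_A(P)\text{ in } D^b(A)\}.$$ **Proposition.** Suppose that $A$ has $\nu$-dominant dimension at least $1$. Then $K^b(\mathrm{stp}(A))$ is the smallest triangulated full subcategory of $K^b(\mathrm{proj}\,A)$ that contains $\mathcal{X}_A$ and is closed under taking direct summands. In particular, every complex in $\mathcal{X}_A$ is isomorphic in $K^b(\mathrm{proj}\,A)$ to a complex in $K^b(\mathrm{stp}(A))$. -/

import Mathlib

open CategoryTheory Limits ZeroObject

universe v u w

namespace NuStable

/-! ### Bounded homotopy categories of additive categories -/

section BoundedHomotopy

variable (C : Type u) [Category.{v} C] [Preadditive C]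

/-- The cochain complexes `K` over `C` with `K.X i = 0` for all but finitely many `i`. -/
def boundedComplexes : ObjectProperty (CochainComplex C ℤ) :=
  fun K ↦ ∃ a b : ℤ, K.IsStrictlyGE a ∧ K.IsStrictlyLE b

/-- The objects of the homotopy category of cochain complexes over `C` whose underlying complex
is bounded. -/
def boundedHomotopy : ObjectProperty (HomotopyCategory C (.up ℤ)) :=
  (boundedComplexes C).strictMap (HomotopyCategory.quotient _ _)

variable {C} in
lemma boundedHomotopy_quotient_obj_iff (K : CochainComplex C ℤ) :
    boundedHomotopy C ((HomotopyCategory.quotient _ _).obj K) ↔ boundedComplexes C K := by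
  refine ⟨?_, fun h ↦ ⟨_, h⟩⟩
  simp only [boundedHomotopy, ObjectProperty.strictMap_iff]
  rintro ⟨L, h, hL⟩
  obtain rfl : L = K := congr_arg Quotient.as hL
  exact h

instance [HasZeroObject C] : (boundedHomotopy C).ContainsZero where
  exists_zero :=
    ⟨(HomotopyCategory.quotient _ _).obj 0, Functor.map_isZero _ (isZero_zero _), by
      rw [boundedHomotopy_quotient_obj_iff]
      exact ⟨0, 0, inferInstance, inferInstance⟩⟩

instance : (boundedHomotopy C).IsStableUnderShift ℤ where
  isStableUnderShiftBy n :=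
    { le_shift K hK := by
        obtain ⟨K : CochainComplex _ _, rfl⟩ := K.quotient_obj_surjective
        rw [boundedHomotopy_quotient_obj_iff] at hK
        obtain ⟨a, b, _, _⟩ := hK
        rw [ObjectProperty.prop_shift_iff, HomotopyCategory.shift_quotient_obj,
          boundedHomotopy_quotient_obj_iff]
        exact ⟨a - n, b - n, K.isStrictlyGE_shift a n (a - n) (by lia),
          K.isStrictlyLE_shift b n (b - n) (by lia)⟩ }

lemma boundedComplexes_mappingCone [HasBinaryBiproducts C] {K L : CochainComplex C ℤ}
    (f : K ⟶ L) (hK : boundedComplexes C K) (hL : boundedComplexes C L) :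
    boundedComplexes C (CochainComplex.mappingCone f) := by
  obtain ⟨a, b, _, _⟩ := hK
  obtain ⟨c, d, _, _⟩ := hL
  refine ⟨min (a - 1) c, max b d, ?_, ?_⟩
  · exact CochainComplex.isStrictlyGE_mappingCone f a c _ (by simp) (by simp)
  · rw [CochainComplex.isStrictlyLE_iff]
    intro i hi
    simp only [sup_lt_iff] at hi
    simp only [CochainComplex.mappingCone.isZero_X_iff]
    exact ⟨K.isZero_of_isStrictlyLE b _, L.isZero_of_isStrictlyLE d _⟩

instance [HasZeroObject C] [HasBinaryBiproducts C] :
    (boundedHomotopy C).IsTriangulatedClosed₃ where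
  ext₃' T hT h₁ h₂ := by
    have h₁' : boundedComplexes C T.obj₁.as := by
      rwa [← boundedHomotopy_quotient_obj_iff]
    have h₂' : boundedComplexes C T.obj₂.as := by
      rwa [← boundedHomotopy_quotient_obj_iff]
    obtain ⟨f : T.obj₁.as ⟶ T.obj₂.as, hf⟩ :=
      (HomotopyCategory.quotient _ _).map_surjective T.mor₁
    refine ⟨_, ?_,
      ⟨Pretriangulated.Triangle.π₃.mapIso (Pretriangulated.isoTriangleOfIso₁₂ T _ hT
        (HomotopyCategory.mappingCone_triangleh_distinguished f)
        (Iso.refl _) (Iso.refl _) ?_)⟩⟩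
    · exact (boundedHomotopy_quotient_obj_iff _).2 (boundedComplexes_mappingCone C f h₁' h₂')
    · exact (Category.comp_id _).trans (hf.symm.trans (Category.id_comp _).symm)

instance [HasZeroObject C] [HasBinaryBiproducts C] : (boundedHomotopy C).IsTriangulated where
  toIsTriangulatedClosed₂ := .of_isTriangulatedClosed₃

/-- The bounded homotopy category `K^b(C)`. It is (pre)triangulated if `C` is additive. -/
abbrev Kb := (boundedHomotopy C).FullSubcategory

variable {C} {D : Type w} [Category.{v} D] [Preadditive D]

/-- The functor `K^b(C) ⥤ K^b(D)` that applies an additive functor `C ⥤ D` componentwise. -/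
noncomputable def mapKb (F : C ⥤ D) [F.Additive] : Kb C ⥤ Kb D :=
  (boundedHomotopy D).lift
    ((boundedHomotopy C).ι ⋙ F.mapHomotopyCategory (ComplexShape.up ℤ)) (by
      rintro ⟨X, hX⟩
      obtain ⟨K, rfl⟩ := HomotopyCategory.quotient_obj_surjective X
      rw [boundedHomotopy_quotient_obj_iff] at hX
      obtain ⟨a, b, _, _⟩ := hX
      exact (boundedHomotopy_quotient_obj_iff _).2 ⟨a, b,
        inferInstanceAs (CochainComplex.IsStrictlyGE ((F.mapHomologicalComplex _).obj K) a),
        inferInstanceAs (CochainComplex.IsStrictlyLE ((F.mapHomologicalComplex _).obj K) b)⟩)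

end BoundedHomotopy

/-! ### Bounded derived categories -/

section BoundedDerived

variable (C : Type u) [Category.{v} C] [Abelian C] [HasDerivedCategory.{w} C]

/-- The bounded derived category `D^b(C)`: the full subcategory of the derived category of `C`
formed by the complexes with bounded cohomology. -/
abbrev Db := (DerivedCategory.TStructure.t (C := C)).bounded.FullSubcategory

/-- The canonical functor `K^b(C) ⥤ D^b(C)`. -/
noncomputable def kbToDb : Kb C ⥤ Db C :=
  (DerivedCategory.TStructure.t (C := C)).bounded.lift
    ((boundedHomotopy C).ι ⋙ DerivedCategory.Qh) (by
      rintro ⟨K, hK⟩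
      obtain ⟨K, rfl⟩ := HomotopyCategory.quotient_obj_surjective K
      obtain ⟨a, b, _, _⟩ := (boundedHomotopy_quotient_obj_iff _).mp hK
      exact ⟨⟨a, DerivedCategory.TStructure.t.isGE_of_iso
          ((DerivedCategory.quotientCompQhIso C).symm.app K) a⟩,
        ⟨b, DerivedCategory.TStructure.t.isLE_of_iso
          ((DerivedCategory.quotientCompQhIso C).symm.app K) b⟩⟩)

end BoundedDerived

/-! ### The Nakayama functor -/

section Nakayama

variable (k A : Type u) [Field k] [Ring A] [Algebra k A]

/-- The `k`-dual `D Hom_A(P, A)` of the right `A`-module `Hom_A(P, A)`. -/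
def NakayamaModule (P : Type u) [AddCommGroup P] [Module A P] : Type u :=
  Module.Dual k (P →ₗ[A] A)

namespace NakayamaModule

variable (P : Type u) [AddCommGroup P] [Module A P]

noncomputable instance : AddCommGroup (NakayamaModule k A P) :=
  inferInstanceAs (AddCommGroup (Module.Dual k (P →ₗ[A] A)))

noncomputable instance : Module k (NakayamaModule k A P) :=
  inferInstanceAs (Module k (Module.Dual k (P →ₗ[A] A)))

/-- Right multiplication `f ↦ f · a`, `(f · a) p = f p * a`, on `Hom_A(P, A)`. -/
def rightMul (a : A) : (P →ₗ[A] A) →ₗ[k] (P →ₗ[A] A) where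
  toFun f := (LinearMap.toSpanSingleton A A a).comp f
  map_add' f g := by ext; simp [add_mul]
  map_smul' c f := by ext; simp

@[simp]
lemma rightMul_apply (a : A) (f : P →ₗ[A] A) (p : P) : rightMul k A P a f p = f p * a := by
  simp [rightMul]

noncomputable instance : FunLike (NakayamaModule k A P) (P →ₗ[A] A) k :=
  inferInstanceAs (FunLike (Module.Dual k (P →ₗ[A] A)) (P →ₗ[A] A) k)

instance : LinearMapClass (NakayamaModule k A P) k (P →ₗ[A] A) k :=
  inferInstanceAs (LinearMapClass (Module.Dual k (P →ₗ[A] A)) k (P →ₗ[A] A) k)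

variable {k A P} in
@[ext]
lemma ext {φ ψ : NakayamaModule k A P} (h : ∀ f, φ f = ψ f) : φ = ψ :=
  DFunLike.ext _ _ h

variable {k A P} in
@[simp]
lemma add_apply (φ ψ : NakayamaModule k A P) (f : P →ₗ[A] A) : (φ + ψ) f = φ f + ψ f := rfl

variable {k A P} in
@[simp]
lemma zero_apply (f : P →ₗ[A] A) : (0 : NakayamaModule k A P) f = 0 := rfl

variable {k A P} in
@[simp]
lemma scalar_apply (c : k) (φ : NakayamaModule k A P) (f : P →ₗ[A] A) :
    (c • φ) f = c * φ f := rfl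

noncomputable instance : SMul A (NakayamaModule k A P) where
  smul a φ := (show Module.Dual k (P →ₗ[A] A) from φ).comp (rightMul k A P a)

variable {k A P} in
@[simp]
lemma smul_apply (a : A) (φ : NakayamaModule k A P) (f : P →ₗ[A] A) :
    (a • φ) f = φ (rightMul k A P a f) := rfl

/-- The left `A`-module structure `(a • φ) f = φ (f · a)`. -/
noncomputable instance : Module A (NakayamaModule k A P) where
  one_smul φ := by
    ext f
    rw [smul_apply]
    congr 1
    ext; simp
  mul_smul a b φ := by
    ext f
    simp only [smul_apply]
    congr 1
    ext; simp [mul_assoc]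
  smul_zero _ := rfl
  smul_add _ _ _ := rfl
  add_smul a b φ := by
    ext f
    rw [add_apply]
    simp only [smul_apply]
    rw [← map_add]
    congr 1
    ext; simp [mul_add]
  zero_smul φ := by
    ext f
    rw [smul_apply, zero_apply, ← map_zero φ]
    congr 1
    ext; simp

instance : IsScalarTower k A (NakayamaModule k A P) where
  smul_assoc c a φ := by
    ext f
    rw [scalar_apply, smul_apply, smul_apply, ← smul_eq_mul, ← map_smul]
    congr 1
    ext; simp

lemma finite_hom [Module.Finite k A] [Module.Finite A P] : Module.Finite k (P →ₗ[A] A) := by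
  obtain ⟨n, s, hs⟩ := Module.Finite.exists_fin (R := A) (M := P)
  let ev : (P →ₗ[A] A) →ₗ[k] (Fin n → A) :=
    { toFun := fun f i ↦ f (s i)
      map_add' := fun f g ↦ rfl
      map_smul' := fun c f ↦ rfl }
  refine Module.Finite.of_injective ev fun f g h ↦ ?_
  refine LinearMap.ext_on_range (v := s) hs fun i ↦ congrFun h i

instance [Module.Finite k A] [Module.Finite A P] : Module.Finite A (NakayamaModule k A P) := by
  have := finite_hom k A P
  have : Module.Finite k (NakayamaModule k A P) :=
    inferInstanceAs (Module.Finite k (Module.Dual k (P →ₗ[A] A)))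
  exact Module.Finite.of_restrictScalars_finite k A _

variable {P} {Q : Type u} [AddCommGroup Q] [Module A Q]

/-- Precomposition `Hom_A(Q, A) → Hom_A(P, A)` with `u : P → Q`. -/
def precomp (u : P →ₗ[A] Q) : (Q →ₗ[A] A) →ₗ[k] (P →ₗ[A] A) where
  toFun f := f.comp u
  map_add' _ _ := rfl
  map_smul' _ _ := rfl

/-- The `A`-linear map `D Hom_A(u, A)`. -/
noncomputable def map (u : P →ₗ[A] Q) : NakayamaModule k A P →ₗ[A] NakayamaModule k A Q where
  toFun φ := (show Module.Dual k (P →ₗ[A] A) from φ).comp (precomp k A u)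
  map_add' _ _ := rfl
  map_smul' _ _ := rfl

variable {k A} in
@[simp]
lemma map_apply (u : P →ₗ[A] Q) (φ : NakayamaModule k A P) (f : Q →ₗ[A] A) :
    map k A u φ f = φ (f.comp u) := rfl

end NakayamaModule

variable [Module.Finite k A]

/-- The Nakayama functor `ν_A = D Hom_A(-, A)` on the category of finitely generated
left `A`-modules. -/
noncomputable def nakayama : FGModuleCat.{u} A ⥤ FGModuleCat.{u} A where
  obj P := FGModuleCat.of A (NakayamaModule k A P)
  map u := FGModuleCat.ofHom (NakayamaModule.map k A u.hom.hom)
  map_id _ := rfl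
  map_comp _ _ := rfl

instance : (nakayama k A).Additive where
  map_add {P Q u v} := by
    apply FGModuleCat.hom_ext
    refine LinearMap.ext fun φ ↦ ?_
    refine NakayamaModule.ext fun f ↦ ?_
    have h : f.comp (u + v).hom.hom = f.comp u.hom.hom + f.comp v.hom.hom :=
      LinearMap.ext fun p ↦ map_add f _ _
    let ψ : NakayamaModule k A P := φ
    change ψ (f.comp (u + v).hom.hom) = ψ (f.comp u.hom.hom) + ψ (f.comp v.hom.hom)
    rw [h, map_add]

end Nakayama

/-! ### Projective and strongly projective-injective modules -/

section Projective

variable (A : Type u) [Ring A]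

/-- The finitely generated `A`-modules that are projective. -/
def isProj : ObjectProperty (FGModuleCat.{u} A) := fun P ↦ Module.Projective A P

/-- The category of finitely generated projective left `A`-modules. -/
abbrev Proj := (isProj A).FullSubcategory

instance : HasZeroObject (Proj A) where
  zero := by
    have : Module.Projective A (PUnit.{u + 1}) := inferInstance
    refine ⟨⟨FGModuleCat.of A PUnit, this⟩, ?_⟩
    rw [IsZero.iff_id_eq_zero]
    apply ObjectProperty.hom_ext
    apply FGModuleCat.hom_ext
    exact LinearMap.ext fun _ ↦ rfl

/-- A morphism of `Proj A` from a linear map. -/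
abbrev projHom {P Q : Proj A} (f : P.obj →ₗ[A] Q.obj) : P ⟶ Q :=
  ObjectProperty.homMk (FGModuleCat.ofHom f)

instance : HasBinaryBiproducts (Proj A) where
  has_binary_biproduct P Q := by
    have hP : Module.Projective A P.obj := P.property
    have hQ : Module.Projective A Q.obj := Q.property
    have h : Module.Projective A (P.obj × Q.obj) := inferInstance
    let S : Proj A := ⟨FGModuleCat.of A (P.obj × Q.obj), h⟩
    refine hasBinaryBiproduct_of_total
      { pt := S
        fst := projHom A (LinearMap.fst A P.obj Q.obj)
        snd := projHom A (LinearMap.snd A P.obj Q.obj)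
        inl := projHom A (LinearMap.inl A P.obj Q.obj)
        inr := projHom A (LinearMap.inr A P.obj Q.obj) } ?_
    apply ObjectProperty.hom_ext
    apply FGModuleCat.hom_ext
    exact LinearMap.ext fun x ↦ Prod.ext (add_zero x.1) (zero_add x.2)

variable (k : Type u) [Field k] [Algebra k A] [Module.Finite k A]

/-- A finitely generated projective module `P` is strongly projective-injective if `ν_A^i(P)` is
projective for all `i > 0`. -/
def isStronglyProjInj : ObjectProperty (FGModuleCat.{u} A) :=
  fun P ↦ isProj A P ∧ ∀ i : ℕ, 0 < i → isProj A ((nakayama k A).obj^[i] P)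

/-- The category `stp(A)`, as a full subcategory of the category of finitely generated projective
modules. -/
abbrev Stp := ((isStronglyProjInj A k).inverseImage (isProj A).ι).FullSubcategory

/-- The inclusion of `stp(A)` into the category of finitely generated projective modules. -/
abbrev stpι : Stp A k ⥤ Proj A := ((isStronglyProjInj A k).inverseImage (isProj A).ι).ι

end Projective

/-! ### The `ν`-dominant dimension -/

section DominantDimension

variable (k A : Type u) [Field k] [Ring A] [Algebra k A] [Module.Finite k A]

/-- A submodule `N` of `M` is essential if it meets every nonzero submodule of `M`. -/
def IsEssentialSubmodule {M : Type u} [AddCommGroup M] [Module A M] (N : Submodule A M) : Prop :=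
  ∀ L : Submodule A M, N ⊓ L = ⊥ → L = ⊥

variable {A} in
/-- An injective resolution `0 → M → I⁰ → I¹ → ⋯` in the category of finitely generated modules
is minimal if `I⁰` is an injective envelope of `M` and every `Iⁿ⁺¹` is an injective envelope of
the image of `Iⁿ → Iⁿ⁺¹`. -/
def IsMinimalResolution [HasZeroObject (FGModuleCat.{u} A)] {M : FGModuleCat.{u} A}
    (I : InjectiveResolution M) : Prop :=
  IsEssentialSubmodule A (LinearMap.range (I.ι.f 0).hom.hom) ∧
    ∀ n : ℕ, IsEssentialSubmodule A (LinearMap.range (I.cocomplex.d n (n + 1)).hom.hom)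

/-- The `ν`-dominant dimension of `A`. -/
noncomputable def nuDominantDimension : ℕ∞ :=
  have : IsNoetherianRing A := IsNoetherianRing.of_finite k A
  sSup {d : ℕ∞ | ∃ I : InjectiveResolution (FGModuleCat.of A A), IsMinimalResolution I ∧
    ∀ i : ℕ, (i : ℕ∞) < d → isStronglyProjInj A k (I.cocomplex.X i)}

end DominantDimension

/-! ### `ν`-invariant complexes -/

section NuInvariant

variable (k A : Type u) [Field k] [Ring A] [Algebra k A] [Module.Finite k A]

/-- The complexes `P` in `K^b(proj A)` such that `P ≅ ν_A(P)` in `D^b(A)`, where `ν_A` is applied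
componentwise. -/
def isNuInvariant : ObjectProperty (Kb (Proj A)) := fun P ↦
  have : IsNoetherianRing A := IsNoetherianRing.of_finite k A
  letI : HasDerivedCategory (FGModuleCat.{u} A) := HasDerivedCategory.standard _
  Nonempty ((kbToDb (FGModuleCat.{u} A)).obj ((mapKb (isProj A).ι).obj P) ≅
    (kbToDb (FGModuleCat.{u} A)).obj ((mapKb ((isProj A).ι ⋙ nakayama k A)).obj P))

/-- `K^b(stp A)` as a full subcategory of `K^b(proj A)` closed under isomorphisms. -/
def kbStp : ObjectProperty (Kb (Proj A)) := (mapKb (stpι A k)).essImage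

/-- A full subcategory of a pretriangulated category is thick if it is triangulated and closed under
direct summands. (In a pretriangulated category the direct summands of an object are exactly its
retracts.) -/
def IsThick {T : Type w} [Category.{v} T] [HasZeroObject T] [HasShift T ℤ] [Preadditive T]
    [∀ n : ℤ, (shiftFunctor T n).Additive] [Pretriangulated T] (S : ObjectProperty T) : Prop :=
  S.IsTriangulated ∧ S.IsStableUnderRetracts

end NuInvariant

end NuStable

/-!
Write `ν` for the Nakayama functor and "stp" for "strongly projective-injective". Everything rests
on the duality `D Hom_A(P, M) ≃ Hom_A(M, ν P)` for `P` finitely generated projective (`dualHom`). It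
shows that `ν P` is injective and that `ν` is fully faithful on projective modules.

*Stp modules.* By the Krull-Schmidt property and a chain argument on trace ideals, `νⁿ⁺¹ P ≅ P` for
some `n` when `P` is indecomposable and stp (`exists_iterate_iso`). Hence every stp module is a
direct summand of an stp module `W` with `ν W ≅ W` (`exists_nakayama_invariant`), and is in
particular injective. Call `S` orthogonal if `Hom(E, S) = 0` for all stp modules `E`; by duality
then also `Hom(S, E) = 0`. If the `ν`-dominant dimension is at least `1`, then `A` embeds in an stp
module, so that `Hom(S, P) = 0` for every projective module `P` (`IsOrthogonal.hom_proj_eq_zero`). A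
projective module is stp if it has no nonzero homomorphism to an orthogonal simple module
(`isStronglyProjInj_of_forall_orthogonal`).

*Complexes.* Every bounded complex of projective modules is homotopy equivalent to a minimal one
(`exists_minimal_complex`). Let `K` be minimal with `K ≅ ν K` in the derived category. As `ν K` has
injective terms, the isomorphism comes from a quasi-isomorphism `K ⟶ ν K`, whose mapping cone is
acyclic. By induction on `m` all `Kᵐ` are stp: as long as the lower terms are stp, the cone has
injective terms in low degrees, so its cycles there split off. A nonzero homomorphism from `Kᵐ` to
an orthogonal simple module `S` dualises to a nonzero homomorphism from `S` to the cycles of `ν K`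
in degree `m`, hence to those of the cone, and these are a direct summand of a sum of modules to
which `S` has no nonzero homomorphisms (`isStronglyProjInj_X_of_quasiIso`).

*The subcategory.* `K^b(stp A)` is triangulated since it contains mapping cones. It is closed under
direct summands by another argument with minimal complexes and orthogonal simple modules
(`isStronglyProjInj_X_of_retract`). It is the smallest such subcategory, as a bounded complex is
built from its terms by triangles (`quotient_obj_of_single`), and an stp module, placed in any
degree, is a direct summand of a `ν`-invariant complex.
-/

namespace NuStable

/-! ### The duality `D Hom_A(P, M) ≃ Hom_A(M, ν P)` -/

section DualBasis

variable {A : Type u} [Ring A] {P : Type u} [AddCommGroup P] [Module A P]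

lemma exists_dual_basis [Module.Finite A P] [Module.Projective A P] :
    ∃ (n : ℕ) (f : Fin n → (P →ₗ[A] A)) (x : Fin n → P), ∀ p, ∑ j, f j p • x j = p := by
  obtain ⟨n, r, i, -, -, h⟩ := Module.Finite.exists_comp_eq_id_of_projective A P
  refine ⟨n, fun j ↦ (LinearMap.proj j).comp i, fun j ↦ r (Pi.single j 1), fun p ↦ ?_⟩
  have h' : r (i p) = p := LinearMap.congr_fun h p
  conv_rhs => rw [← h', LinearMap.pi_apply_eq_sum_univ r (i p)]
  refine Finset.sum_congr rfl fun j _ ↦ ?_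
  simp only [LinearMap.comp_apply, LinearMap.proj_apply]
  congr 2
  ext l
  simp [Pi.single_apply, eq_comm]

lemma exists_hom_ne_zero_of_projective [Module.Finite A P] [Module.Projective A P] {p : P}
    (hp : p ≠ 0) : ∃ f : P →ₗ[A] A, f p ≠ 0 := by
  obtain ⟨n, f, x, h⟩ := exists_dual_basis (A := A) (P := P)
  by_contra! H
  exact hp (by simpa [H] using (h p).symm)

end DualBasis

section Duality

variable (k : Type u) {A : Type u} [Field k] [Ring A] [Algebra k A]
variable {P Q : Type u} [AddCommGroup P] [Module A P] [AddCommGroup Q] [Module A Q]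
variable {M N : Type u} [AddCommGroup M] [Module A M] [AddCommGroup N] [Module A N]

/-- The map `p ↦ f p • m` attached to `f : P → A` and `m : M`. -/
abbrev smulHom (f : P →ₗ[A] A) (m : M) : P →ₗ[A] M :=
  (LinearMap.toSpanSingleton A M m).comp f

/-- A functional `φ` on `Hom_A(P, M)` gives the homomorphism `M → ν P` that sends `m` to
`f ↦ φ (p ↦ f p • m)`. -/
def dualHom [Module k M] [IsScalarTower k A M] (φ : Module.Dual k (P →ₗ[A] M)) :
    M →ₗ[A] NakayamaModule k A P where
  toFun m := show Module.Dual k (P →ₗ[A] A) from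
    { toFun := fun f ↦ φ (smulHom f m)
      map_add' := fun f g ↦ by
        rw [← map_add]; congr 1; ext; simp [add_smul]
      map_smul' := fun c f ↦ by
        rw [← map_smul]; congr 1; ext; simp }
  map_add' m n := by
    refine NakayamaModule.ext fun f ↦ ?_
    change φ _ = φ _ + φ _
    rw [← map_add]; congr 1; ext; simp
  map_smul' a m := by
    refine NakayamaModule.ext fun f ↦ ?_
    change φ _ = φ _
    congr 1; ext; simp [mul_smul]

variable {k}

@[simp]
lemma dualHom_apply [Module k M] [IsScalarTower k A M] (φ : Module.Dual k (P →ₗ[A] M)) (m : M)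
    (f : P →ₗ[A] A) : dualHom k φ m f = φ (smulHom f m) := rfl

/-- The homomorphisms `p ↦ f p • m` span `Hom_A(P, M)`, by the dual basis lemma. -/
lemma dualHom_injective [Module k M] [IsScalarTower k A M] [Module.Finite A P]
    [Module.Projective A P] {φ : Module.Dual k (P →ₗ[A] M)} (h : dualHom k φ = 0) : φ = 0 := by
  obtain ⟨n, f, x, hx⟩ := exists_dual_basis (A := A) (P := P)
  ext g
  have hg : g = ∑ j, smulHom (f j) (g (x j)) := by
    ext p
    conv_lhs => rw [← hx p]
    simp
  rw [hg, map_sum]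
  refine Finset.sum_eq_zero fun j _ ↦ ?_
  rw [← dualHom_apply, h]
  rfl

lemma dualHom_surjective [Module k M] [IsScalarTower k A M] [Module.Finite A P]
    [Module.Projective A P] (h : M →ₗ[A] NakayamaModule k A P) :
    ∃ φ : Module.Dual k (P →ₗ[A] M), dualHom k φ = h := by
  obtain ⟨n, f, x, hx⟩ := exists_dual_basis (A := A) (P := P)
  have hk (c : k) (m : M) : h (c • m) = c • h m := by
    rw [← algebraMap_smul A c m, map_smul, algebraMap_smul]
  let φ : Module.Dual k (P →ₗ[A] M) :=
    { toFun := fun g ↦ ∑ j, h (g (x j)) (f j)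
      map_add' := fun g g' ↦ by simp [Finset.sum_add_distrib]
      map_smul' := fun c g ↦ by simp [hk, Finset.mul_sum] }
  refine ⟨φ, LinearMap.ext fun m ↦ NakayamaModule.ext fun g ↦ ?_⟩
  change ∑ j, h ((smulHom g m) (x j)) (f j) = h m g
  have hg : g = ∑ j, NakayamaModule.rightMul k A P (g (x j)) (f j) := by
    ext p
    conv_lhs => rw [← hx p]
    simp
  conv_rhs => rw [hg, map_sum]
  simp

lemma map_comp_dualHom [Module k M] [IsScalarTower k A M] (d : P →ₗ[A] Q)
    (φ : Module.Dual k (P →ₗ[A] M)) (hd : ∀ g : Q →ₗ[A] M, φ (g.comp d) = 0) :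
    (NakayamaModule.map k A d).comp (dualHom k φ) = 0 := by
  refine LinearMap.ext fun m ↦ NakayamaModule.ext fun f ↦ ?_
  exact hd (smulHom f m)

variable (k)

/-- A nonzero `g : P → M` yields a nonzero `M → ν P`, which is annihilated by `ν d` for every
`d : P → Q` such that all homomorphisms `Q → M` vanish on the image of `d`. -/
lemma exists_hom_nakayama_ne_zero [Module.Finite A P] [Module.Projective A P]
    {g : P →ₗ[A] M} (hg : g ≠ 0) :
    ∃ h : M →ₗ[A] NakayamaModule k A P, h ≠ 0 ∧
      ∀ (Q : Type u) [AddCommGroup Q] [Module A Q] (d : P →ₗ[A] Q),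
        (∀ g' : Q →ₗ[A] M, g'.comp d = 0) → (NakayamaModule.map k A d).comp h = 0 := by
  let : Module k M := Module.compHom M (algebraMap k A)
  have : IsScalarTower k A M := IsScalarTower.of_algebraMap_smul fun _ _ ↦ rfl
  obtain ⟨φ, hφ⟩ : ∃ φ : Module.Dual k (P →ₗ[A] M), φ g ≠ 0 := by
    by_contra! H
    exact hg ((Module.forall_dual_apply_eq_zero_iff k g).1 H)
  refine ⟨dualHom k φ, fun h ↦ hφ (by rw [dualHom_injective h]; rfl), fun Q _ _ d hd ↦ ?_⟩
  exact map_comp_dualHom d φ fun g' ↦ by rw [hd, map_zero]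

lemma hom_nakayama_eq_zero [Module.Finite A P] [Module.Projective A P]
    (H : ∀ g : P →ₗ[A] M, g = 0) (h : M →ₗ[A] NakayamaModule k A P) : h = 0 := by
  let : Module k M := Module.compHom M (algebraMap k A)
  have : IsScalarTower k A M := IsScalarTower.of_algebraMap_smul fun _ _ ↦ rfl
  obtain ⟨φ, rfl⟩ := dualHom_surjective h
  refine LinearMap.ext fun m ↦ NakayamaModule.ext fun f ↦ ?_
  rw [dualHom_apply, H (smulHom f m), map_zero]
  rfl

/-- `ν P` is injective: under `Hom_A(-, ν P) ≃ D Hom_A(P, -)`, extending a homomorphism along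
`i : M → N` amounts to extending a functional from `Hom_A(P, M)` to `Hom_A(P, N)`. -/
lemma exists_extension_nakayama [Module.Finite A P] [Module.Projective A P]
    (i : M →ₗ[A] N) (hi : Function.Injective i) (h : M →ₗ[A] NakayamaModule k A P) :
    ∃ h' : N →ₗ[A] NakayamaModule k A P, h'.comp i = h := by
  let : Module k M := Module.compHom M (algebraMap k A)
  have : IsScalarTower k A M := IsScalarTower.of_algebraMap_smul fun _ _ ↦ rfl
  let : Module k N := Module.compHom N (algebraMap k A)
  have : IsScalarTower k A N := IsScalarTower.of_algebraMap_smul fun _ _ ↦ rfl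
  obtain ⟨φ, rfl⟩ := dualHom_surjective h
  let c : (P →ₗ[A] M) →ₗ[k] (P →ₗ[A] N) :=
    { toFun := fun g ↦ i.comp g
      map_add' := fun g g' ↦ by ext; simp
      map_smul' := fun c g ↦ by
        ext p
        exact map_smul i (algebraMap k A c) (g p) }
  have hc : Function.Injective c := fun g g' hg ↦
    LinearMap.ext fun p ↦ hi (LinearMap.congr_fun hg p)
  obtain ⟨r, hr⟩ := c.exists_leftInverse_of_injective (LinearMap.ker_eq_bot.2 hc)
  refine ⟨dualHom k (φ.comp r), LinearMap.ext fun m ↦ NakayamaModule.ext fun f ↦ ?_⟩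
  have : smulHom f (i m) = c (smulHom f m) := by
    ext p
    simp [c]
  rw [LinearMap.comp_apply, dualHom_apply, dualHom_apply, this, LinearMap.comp_apply]
  exact congrArg φ (LinearMap.congr_fun hr _)

lemma nakayamaMap_injective [Module.Finite A Q] [Module.Projective A Q] {u u' : P →ₗ[A] Q}
    (h : NakayamaModule.map k A u = NakayamaModule.map k A u') : u = u' := by
  ext p
  by_contra hp
  obtain ⟨f, hf⟩ := exists_hom_ne_zero_of_projective (A := A) (sub_ne_zero.2 hp)
  have : f.comp u - f.comp u' = 0 := by
    refine (Module.forall_dual_apply_eq_zero_iff k _).1 fun φ ↦ ?_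
    have := DFunLike.congr_fun (LinearMap.congr_fun h (φ : NakayamaModule k A P)) f
    rw [map_sub]
    exact sub_eq_zero.2 this
  exact hf (by simpa using LinearMap.congr_fun this p)

variable (A) in
lemma finite_linearMap [Module.Finite k A] [Module.Finite A P] [Module.Finite A Q] [Module k Q]
    [IsScalarTower k A Q] : Module.Finite k (P →ₗ[A] Q) := by
  have : Module.Finite k Q := Module.Finite.trans A Q
  obtain ⟨n, s, hs⟩ := Module.Finite.exists_fin (R := A) (M := P)
  let ev : (P →ₗ[A] Q) →ₗ[k] (Fin n → Q) :=
    { toFun := fun f i ↦ f (s i)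
      map_add' := fun f g ↦ rfl
      map_smul' := fun c f ↦ rfl }
  exact Module.Finite.of_injective ev fun f g h ↦
    LinearMap.ext_on_range (v := s) hs fun i ↦ congrFun h i

/-- `ν` is full on projective modules, since
`Hom_A(ν P, ν Q) ≃ D Hom_A(Q, ν P) ≃ D D Hom_A(P, Q) ≃ Hom_A(P, Q)`. -/
lemma nakayamaMap_surjective [Module.Finite k A] [Module.Finite A P] [Module.Finite A Q]
    [Module.Projective A Q]
    (h : NakayamaModule k A P →ₗ[A] NakayamaModule k A Q) :
    ∃ u : P →ₗ[A] Q, NakayamaModule.map k A u = h := by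
  let : Module k Q := Module.compHom Q (algebraMap k A)
  have : IsScalarTower k A Q := IsScalarTower.of_algebraMap_smul fun _ _ ↦ rfl
  have : Module.Finite k (P →ₗ[A] Q) := finite_linearMap k A
  obtain ⟨φ, rfl⟩ := dualHom_surjective h
  let T : Module.Dual k (Module.Dual k (P →ₗ[A] Q)) :=
    { toFun := fun χ ↦ φ (dualHom k χ)
      map_add' := fun χ χ' ↦ by rw [← map_add]; rfl
      map_smul' := fun c χ ↦ by rw [← map_smul]; rfl }
  obtain ⟨u, hu⟩ := (Module.evalEquiv k (P →ₗ[A] Q)).surjective T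
  refine ⟨u, LinearMap.ext fun ψ ↦ NakayamaModule.ext fun f ↦ ?_⟩
  let c : (P →ₗ[A] Q) →ₗ[k] (P →ₗ[A] A) :=
    { toFun := fun g ↦ f.comp g
      map_add' := fun g g' ↦ by ext; simp
      map_smul' := fun c g ↦ by
        ext p
        exact (map_smul f (algebraMap k A c) (g p)).trans (algebraMap_smul A c (f (g p))) }
  let χ : Module.Dual k (P →ₗ[A] Q) := (show Module.Dual k (P →ₗ[A] A) from ψ).comp c
  have hχ : dualHom k χ = smulHom f ψ := by
    refine LinearMap.ext fun q ↦ NakayamaModule.ext fun f' ↦ ?_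
    change ψ (f.comp (smulHom f' q)) = ψ (NakayamaModule.rightMul k A P (f q) f')
    congr 1
    ext p
    simp
  have := LinearMap.congr_fun hu χ
  rw [dualHom_apply, ← hχ]
  exact this

end Duality

/-! ### Finite-dimensional algebras and indecomposable modules -/

/-- A non-nilpotent element `u` of a finite-dimensional algebra has a nonzero outer inverse `w`:
the powers of `u` stabilise, `uⁿ = u²ⁿ⁺¹ c` for some `c` that commutes with `u`, and `w = uⁿ c`. -/
lemma exists_outer_inverse (k : Type*) {B : Type*} [Field k] [Ring B] [Algebra k B]
    [Module.Finite k B] {u : B} (hu : ¬ IsNilpotent u) : ∃ w : B, w ≠ 0 ∧ w * u * w = w := by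
  let S := Algebra.adjoin k {u}
  have : IsMulCommutative S := Algebra.isMulCommutative_adjoin k (by simp)
  have : Module.Finite k S := inferInstanceAs (Module.Finite k S.toSubmodule)
  have : IsArtinianRing S := IsArtinianRing.of_finite k S
  let x : S := ⟨u, Algebra.subset_adjoin rfl⟩
  obtain ⟨n, y, hy⟩ := IsArtinian.exists_pow_succ_smul_dvd x (1 : S)
  have hy' : x ^ n = x ^ n * (x * y) := by
    simp only [smul_eq_mul, mul_one] at hy
    rw [← hy, Nat.succ_eq_add_one, hy]
    conv_lhs => rw [← hy]
    rw [pow_succ, mul_assoc]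
  have hpow (m : ℕ) : x ^ n = x ^ n * (x * y) ^ m := by
    induction m with
    | zero => simp
    | succ m ih => rw [pow_succ', ← mul_assoc, ← hy', ← ih]
  set c := y ^ (n + 1) with hc
  have hxc : x ^ n = x ^ n * x ^ (n + 1) * c := by
    rw [mul_assoc, hc, ← mul_pow, ← hpow]
  refine ⟨(x ^ n * c : S), fun h ↦ hu ⟨n, ?_⟩, ?_⟩
  · have h0 : x ^ n * c = 0 := Subtype.ext h
    have : x ^ n = 0 := by
      rw [hxc, mul_assoc, mul_comm (x ^ (n + 1)), ← mul_assoc, h0, zero_mul]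
    exact congrArg Subtype.val this
  · have : (x ^ n * c) * x * (x ^ n * c) = x ^ n * c := by
      conv_rhs => rw [hxc]
      ring
    exact congrArg Subtype.val this

lemma isLocalRing_of_idempotents (k : Type*) {B : Type*} [Field k] [Ring B] [Algebra k B]
    [Module.Finite k B] [Nontrivial B] (h : ∀ e : B, e * e = e → e = 0 ∨ e = 1) :
    IsLocalRing B where
  isUnit_or_isUnit_of_add_one {a b} hab := by
    by_cases ha : IsNilpotent a
    · right
      rw [← sub_eq_of_eq_add' hab.symm]
      exact ha.isUnit_one_sub
    · left
      obtain ⟨w, hw, hw'⟩ := exists_outer_inverse k ha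
      have h₁ : w * a = 1 := (h (w * a) (by rw [← mul_assoc, hw'])).resolve_left fun h0 ↦
        hw (by rw [← hw', h0, zero_mul])
      have h₂ : a * w = 1 := (h (a * w) (by rw [mul_assoc, ← mul_assoc w, hw'])).resolve_left
        fun h0 ↦ hw (by rw [← hw', mul_assoc, h0, mul_zero])
      exact ⟨⟨a, w, h₂, h₁⟩, rfl⟩

section

variable {C : Type u} [Category.{v} C] [Preadditive C]

/-- `Y` is a direct summand of the finite direct sum of the objects `X l`. The direct sum itself
need not exist. -/
def IsSummandOfSum {n : ℕ} (X : Fin n → C) (Y : C) : Prop :=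
  ∃ (b : ∀ l, Y ⟶ X l) (a : ∀ l, X l ⟶ Y), ∑ l, b l ≫ a l = 𝟙 Y

lemma IsSummandOfSum.map {D : Type w} [Category.{v} D] [Preadditive D] (F : C ⥤ D) [F.Additive]
    {n : ℕ} {X : Fin n → C} {Y : C} (h : IsSummandOfSum X Y) :
    IsSummandOfSum (fun l ↦ F.obj (X l)) (F.obj Y) := by
  obtain ⟨b, a, h⟩ := h
  refine ⟨fun l ↦ F.map (b l), fun l ↦ F.map (a l), ?_⟩
  simp only [← F.map_comp, ← F.map_sum, h, F.map_id]

lemma isSummandOfSum_of_isZero {Y : C} (h : IsZero Y) :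
    IsSummandOfSum (fun l : Fin 0 ↦ l.elim0) Y :=
  ⟨fun l ↦ l.elim0, fun l ↦ l.elim0, h.eq_of_src _ _⟩

lemma isSummandOfSum_of_retract {X Y : C} (h : Retract Y X) :
    IsSummandOfSum (fun _ : Fin 1 ↦ X) Y :=
  ⟨fun _ ↦ h.i, fun _ ↦ h.r, by simp⟩

lemma isSummandOfSum_biproduct {n : ℕ} (X : Fin n → C) [HasBiproduct X] :
    IsSummandOfSum X (⨁ X) :=
  ⟨biproduct.π X, biproduct.ι X, biproduct.total⟩

/-- An object is indecomposable if it is nonzero and its only idempotent endomorphisms are `0`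
and `1`. -/
def IsIndecomposable (Q : C) : Prop :=
  𝟙 Q ≠ 0 ∧ ∀ e : Q ⟶ Q, e ≫ e = e → e = 0 ∨ e = 𝟙 Q

lemma IsIndecomposable.isIso_of_retract {Q X : C} (hX : IsIndecomposable X)
    (hQ : IsIndecomposable Q) (h : Retract Q X) : IsIso h.i := by
  refine ⟨h.r, h.retract, (hX.2 (h.r ≫ h.i) (by simp)).resolve_left fun h0 ↦ hQ.1 ?_⟩
  calc 𝟙 Q = h.i ≫ (h.r ≫ h.i) ≫ h.r := by simp
    _ = 0 := by rw [h0, zero_comp, comp_zero]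

end

section Modules

variable {A : Type u} [Ring A]

lemma sum_hom_hom {P Q : FGModuleCat.{u} A} {ι : Type*} (s : Finset ι) (f : ι → (P ⟶ Q)) :
    (∑ l ∈ s, f l).hom.hom = ∑ l ∈ s, (f l).hom.hom := by
  classical
  induction s using Finset.induction_on with
  | empty => rfl
  | insert l s hl ih => rw [Finset.sum_insert hl, Finset.sum_insert hl, ← ih]; rfl

lemma injective_of_mono {M N : FGModuleCat.{u} A} (f : M ⟶ N) [Mono f] :
    Function.Injective f.hom.hom := by
  rw [injective_iff_map_eq_zero]
  intro x hx
  let g : FGModuleCat.of A A ⟶ M := FGModuleCat.ofHom (LinearMap.toSpanSingleton A M x)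
  have hg : g ≫ f = 0 := by
    ext : 1
    refine LinearMap.ext_ring ?_
    change f.hom.hom ((1 : A) • x) = 0
    rw [one_smul, hx]
  have hg' : g = 0 := by rw [← cancel_mono f, hg, zero_comp]
  have : (1 : A) • x = 0 := congrArg (fun φ : FGModuleCat.of A A ⟶ M ↦ φ.hom.hom (1 : A)) hg'
  rwa [one_smul] at this

/-- Idempotents split in the category of finitely generated modules. -/
lemma exists_splitting {Q : FGModuleCat.{u} A} (e : Q ⟶ Q) (he : e ≫ e = e) :
    ∃ (Y : FGModuleCat.{u} A) (i : Y ⟶ Q) (r : Q ⟶ Y), i ≫ r = 𝟙 Y ∧ r ≫ i = e := by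
  let R := LinearMap.range e.hom.hom
  have hfin : Module.Finite A R := Module.Finite.range _
  refine ⟨FGModuleCat.of A R, FGModuleCat.ofHom R.subtype,
    FGModuleCat.ofHom e.hom.hom.rangeRestrict, ?_, rfl⟩
  ext : 1
  refine LinearMap.ext fun x ↦ ?_
  obtain ⟨_, y, rfl⟩ := x
  exact Subtype.ext (congrArg (fun φ : Q ⟶ Q ↦ φ.hom.hom y) he)

lemma isZero_of_id_eq_zero {Q : FGModuleCat.{u} A} (h : 𝟙 Q = 0) : IsZero Q :=
  (IsZero.iff_id_eq_zero _).2 h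

lemma isProj_of_isSummandOfSum {n : ℕ} {X : Fin n → FGModuleCat.{u} A} {Y : FGModuleCat.{u} A}
    (h : IsSummandOfSum X Y) (hX : ∀ l, isProj A (X l)) : isProj A Y := by
  obtain ⟨b, a, h⟩ := h
  refine Module.Projective.of_lifting_property'' fun f hf ↦ ?_
  have H (l) : ∃ c : X l →ₗ[A] (Y →₀ A), f.comp c = (a l).hom.hom :=
    have : Module.Projective A (X l) := hX l
    Module.projective_lifting_property f (a l).hom.hom hf
  choose c hc using H
  refine ⟨∑ l, (c l).comp (b l).hom.hom, ?_⟩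
  have h' := congrArg (fun φ : Y ⟶ Y ↦ φ.hom.hom) h
  simp only [sum_hom_hom] at h'
  refine Eq.trans ?_ h'
  ext y
  simp only [LinearMap.comp_apply, LinearMap.sum_apply, map_sum]
  exact Finset.sum_congr rfl fun l _ ↦ LinearMap.congr_fun (hc l) _

/-- If a projective module is the sum of the images of homomorphisms from modules in a class,
then it is a direct summand of a finite direct sum of modules in that class. -/
lemma exists_isSummandOfSum {Q : FGModuleCat.{u} A} (hQ : isProj A Q)
    (𝒳 : ObjectProperty (FGModuleCat.{u} A))
    (h : ∀ U : Submodule A Q, (∀ X, 𝒳 X → ∀ g : X ⟶ Q, LinearMap.range g.hom.hom ≤ U) → U = ⊤) :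
    ∃ (n : ℕ) (X : Fin n → FGModuleCat.{u} A), (∀ l, 𝒳 (X l)) ∧ IsSummandOfSum X Q := by
  have : Module.Projective A Q := hQ
  let J := Σ X : {X // 𝒳 X}, (X.1 ⟶ Q)
  have htop : (⊤ : Submodule A Q) ≤ ⨆ j : J, LinearMap.range j.2.hom.hom :=
    (h _ fun X hX g ↦ le_iSup (fun j : J ↦ LinearMap.range j.2.hom.hom) ⟨⟨X, hX⟩, g⟩).ge
  obtain ⟨t, ht⟩ := CompleteLattice.IsCompactElement.exists_finset_of_le_iSup _
    ((Submodule.fg_iff_compact _).1 (Module.Finite.fg_top (R := A) (M := Q))) _ htop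
  let X : Fin t.card → FGModuleCat.{u} A := fun l ↦ (t.equivFin.symm l).1.1.1
  let g (l : Fin t.card) : X l ⟶ Q := (t.equivFin.symm l).1.2
  let f : (∀ l, X l) →ₗ[A] Q := ∑ l, (g l).hom.hom.comp (LinearMap.proj l)
  have hf : Function.Surjective f := by
    rw [← LinearMap.range_eq_top, ← top_le_iff]
    refine ht.trans (iSup₂_le fun j hj ↦ ?_)
    obtain ⟨l, hl⟩ := t.equivFin.symm.surjective ⟨j, hj⟩
    obtain rfl : (t.equivFin.symm l).1 = j := by rw [hl]
    rintro _ ⟨x, rfl⟩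
    refine ⟨Pi.single l x, ?_⟩
    simp only [f, LinearMap.sum_apply, LinearMap.comp_apply, LinearMap.proj_apply]
    rw [Finset.sum_eq_single l (fun m _ hm ↦ by rw [Pi.single_eq_of_ne hm, map_zero]) (by simp),
      Pi.single_eq_same]
  obtain ⟨s, hs⟩ := Module.projective_lifting_property f LinearMap.id hf
  refine ⟨t.card, X, fun l ↦ (t.equivFin.symm l).1.1.2,
    fun l ↦ FGModuleCat.ofHom ((LinearMap.proj l).comp s), g, ?_⟩
  ext q
  rw [sum_hom_hom]
  have := LinearMap.congr_fun hs q
  simp only [f, LinearMap.comp_apply, LinearMap.sum_apply] at this ⊢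
  exact this

variable (k : Type u) [Field k] [Algebra k A] [Module.Finite k A]

include k in
/-- An endomorphism `u` of `Q` with `u ≫ g = g ≠ 0` is not nilpotent, hence has a nonzero outer
inverse. -/
lemma exists_outer_inverse_hom {Q S : FGModuleCat.{u} A} (u : Q ⟶ Q) (g : Q ⟶ S) (hg : g ≠ 0)
    (hu : u ≫ g = g) : ∃ w : Q ⟶ Q, w ≠ 0 ∧ w ≫ u ≫ w = w := by
  let : Module k Q := Module.compHom Q (algebraMap k A)
  have : IsScalarTower k A Q := IsScalarTower.of_algebraMap_smul fun _ _ ↦ rfl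
  have : Module.Finite k (Q →ₗ[A] Q) := finite_linearMap k A
  have hpow (n : ℕ) : g.hom.hom.comp ((u.hom.hom : Module.End A Q) ^ n) = g.hom.hom := by
    induction n with
    | zero => rfl
    | succ n ih =>
      rw [pow_succ, Module.End.mul_eq_comp, ← LinearMap.comp_assoc, ih]
      exact congrArg (fun φ : Q ⟶ S ↦ φ.hom.hom) hu
  obtain ⟨w, hw, hw'⟩ := exists_outer_inverse k (B := Module.End A Q) (u := u.hom.hom) (by
    rintro ⟨n, hn⟩
    refine hg ?_
    ext : 1
    rw [← hpow n, hn, LinearMap.comp_zero]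
    rfl)
  refine ⟨FGModuleCat.ofHom w, fun h ↦ hw (congrArg (fun φ : Q ⟶ Q ↦ φ.hom.hom) h), ?_⟩
  ext : 1
  exact hw'

include k in
/-- The Krull-Schmidt property: an indecomposable summand of a finite direct sum is a summand of
one of the terms, as its endomorphism ring is local. -/
lemma exists_retract_of_isSummandOfSum {n : ℕ} {X : Fin n → FGModuleCat.{u} A}
    {Q : FGModuleCat.{u} A} (hQ : IsIndecomposable Q) (h : IsSummandOfSum X Q) :
    ∃ l, Nonempty (Retract Q (X l)) := by
  let : Module k Q := Module.compHom Q (algebraMap k A)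
  have : IsScalarTower k A Q := IsScalarTower.of_algebraMap_smul fun _ _ ↦ rfl
  have : Module.Finite k (Module.End A Q) := finite_linearMap k A
  have : Nontrivial (Module.End A Q) := by
    refine ⟨1, 0, fun h ↦ hQ.1 ?_⟩
    ext : 1
    exact h
  have : IsLocalRing (Module.End A Q) := isLocalRing_of_idempotents k fun e he ↦ by
    have : FGModuleCat.ofHom e ≫ FGModuleCat.ofHom e = FGModuleCat.ofHom e := by
      ext : 1
      exact he
    exact (hQ.2 _ this).imp (congrArg (fun φ : Q ⟶ Q ↦ φ.hom.hom))
      (congrArg (fun φ : Q ⟶ Q ↦ φ.hom.hom))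
  obtain ⟨b, a, h⟩ := h
  have h' := congrArg (fun φ : Q ⟶ Q ↦ φ.hom.hom) h
  simp only [sum_hom_hom] at h'
  have h1 : IsUnit (∑ l, ((b l ≫ a l).hom.hom : Module.End A Q)) := by
    rw [h']
    exact isUnit_one
  obtain ⟨l, -, ⟨⟨x, y, hxy, hyx⟩, rfl : x = _⟩⟩ := IsLocalRing.exists_of_isUnit_sum h1
  refine ⟨l, ⟨b l, a l ≫ FGModuleCat.ofHom y, ?_⟩⟩
  ext : 1
  exact hyx

/-- The dimension over `k` of a finitely generated `A`-module, with `k` acting through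
`algebraMap k A`. -/
noncomputable def kdim (M : FGModuleCat.{u} A) : ℕ :=
  let : Module k M := Module.compHom M (algebraMap k A)
  Module.finrank k M

lemma kdim_le_of_retract {M N : FGModuleCat.{u} A} (h : Retract M N) : kdim k M ≤ kdim k N := by
  let : Module k M := Module.compHom M (algebraMap k A)
  have : IsScalarTower k A M := IsScalarTower.of_algebraMap_smul fun _ _ ↦ rfl
  let : Module k N := Module.compHom N (algebraMap k A)
  have : IsScalarTower k A N := IsScalarTower.of_algebraMap_smul fun _ _ ↦ rfl
  have : Module.Finite k N := Module.Finite.trans A N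
  have hinj : Function.Injective h.i.hom.hom := fun x y hxy ↦ by
    have := congrArg h.r.hom.hom hxy
    have hr (x : M) : h.r.hom.hom (h.i.hom.hom x) = x :=
      congrArg (fun φ : M ⟶ M ↦ φ.hom.hom x) h.retract
    rwa [hr, hr] at this
  exact LinearMap.finrank_le_finrank_of_injective (f := h.i.hom.hom.restrictScalars k) hinj

lemma kdim_lt_of_retract {M N : FGModuleCat.{u} A} (h : Retract M N) (hi : h.r ≫ h.i ≠ 𝟙 N) :
    kdim k M < kdim k N := by
  let : Module k M := Module.compHom M (algebraMap k A)
  have : IsScalarTower k A M := IsScalarTower.of_algebraMap_smul fun _ _ ↦ rfl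
  let : Module k N := Module.compHom N (algebraMap k A)
  have : IsScalarTower k A N := IsScalarTower.of_algebraMap_smul fun _ _ ↦ rfl
  have : Module.Finite k N := Module.Finite.trans A N
  have : Module.Finite k M := Module.Finite.trans A M
  refine lt_of_le_of_ne (kdim_le_of_retract k h) fun heq ↦ hi ?_
  have hri (x : M) : h.r.hom.hom (h.i.hom.hom x) = x :=
    congrArg (fun φ : M ⟶ M ↦ φ.hom.hom x) h.retract
  have hinj : Function.Injective (h.r.hom.hom.restrictScalars k) :=
    (LinearMap.injective_iff_surjective_of_finrank_eq_finrank (K := k) heq.symm).2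
      fun x ↦ ⟨h.i.hom.hom x, hri x⟩
  ext x
  exact hinj (hri (h.r.hom.hom x))

end Modules

/-! ### Strongly projective-injective modules -/

section StronglyProjInj

variable (k : Type u) {A : Type u} [Field k] [Ring A] [Algebra k A] [Module.Finite k A]

lemma injective_nakayama_obj {P : FGModuleCat.{u} A} (hP : isProj A P) :
    Injective ((nakayama k A).obj P) where
  factors {M N} h i _ := by
    have : Module.Projective A P := hP
    obtain ⟨h', hh'⟩ := exists_extension_nakayama k i.hom.hom (injective_of_mono i) h.hom.hom
    exact ⟨FGModuleCat.ofHom h', FGModuleCat.hom_ext hh'⟩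

lemma nakayama_map_injective {P Q : FGModuleCat.{u} A} (hQ : isProj A Q) {u u' : P ⟶ Q}
    (h : (nakayama k A).map u = (nakayama k A).map u') : u = u' := by
  have : Module.Projective A Q := hQ
  ext : 1
  exact nakayamaMap_injective k (congrArg (fun φ : (nakayama k A).obj P ⟶ (nakayama k A).obj Q ↦
    φ.hom.hom) h)

lemma nakayama_map_surjective {P Q : FGModuleCat.{u} A} (hQ : isProj A Q)
    (h : (nakayama k A).obj P ⟶ (nakayama k A).obj Q) : ∃ u, (nakayama k A).map u = h := by
  have : Module.Projective A Q := hQ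
  obtain ⟨u, hu⟩ := nakayamaMap_surjective k h.hom.hom
  exact ⟨FGModuleCat.ofHom u, FGModuleCat.hom_ext hu⟩

lemma nonempty_iso_of_nakayama {P Q : FGModuleCat.{u} A} (hP : isProj A P) (hQ : isProj A Q)
    (e : (nakayama k A).obj P ≅ (nakayama k A).obj Q) : Nonempty (P ≅ Q) := by
  obtain ⟨u, hu⟩ := nakayama_map_surjective k hQ e.hom
  obtain ⟨v, hv⟩ := nakayama_map_surjective k hP e.inv
  exact ⟨⟨u, v, nakayama_map_injective k hP (by simp [hu, hv]),
    nakayama_map_injective k hQ (by simp [hu, hv])⟩⟩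

lemma IsIndecomposable.nakayama_obj {P : FGModuleCat.{u} A} (h : IsIndecomposable P)
    (hP : isProj A P) : IsIndecomposable ((nakayama k A).obj P) := by
  refine ⟨fun h0 ↦ h.1 (nakayama_map_injective k hP (by simpa using h0)), fun e he ↦ ?_⟩
  obtain ⟨u, rfl⟩ := nakayama_map_surjective k hP e
  rw [← Functor.map_comp] at he
  refine (h.2 u (nakayama_map_injective k hP he)).imp ?_ ?_
  · rintro rfl
    simp
  · rintro rfl
    simp

variable {k}

lemma isStronglyProjInj_iff {P : FGModuleCat.{u} A} :
    isStronglyProjInj A k P ↔ ∀ i : ℕ, isProj A ((nakayama k A).obj^[i] P) :=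
  ⟨fun h i ↦ i.eq_zero_or_pos.elim (fun hi ↦ hi ▸ h.1) (h.2 i), fun h ↦ ⟨h 0, fun i _ ↦ h i⟩⟩

lemma isStronglyProjInj_nakayama {P : FGModuleCat.{u} A} (h : isStronglyProjInj A k P) :
    isStronglyProjInj A k ((nakayama k A).obj P) :=
  isStronglyProjInj_iff.2 fun i ↦ isStronglyProjInj_iff.1 h (i + 1)

lemma isStronglyProjInj_iterate {P : FGModuleCat.{u} A} (h : isStronglyProjInj A k P) (i : ℕ) :
    isStronglyProjInj A k ((nakayama k A).obj^[i] P) := by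
  induction i with
  | zero => exact h
  | succ i ih =>
    rw [Function.iterate_succ_apply']
    exact isStronglyProjInj_nakayama ih

lemma isStronglyProjInj_of_isSummandOfSum {n : ℕ} {X : Fin n → FGModuleCat.{u} A}
    {Y : FGModuleCat.{u} A} (h : IsSummandOfSum X Y) (hX : ∀ l, isStronglyProjInj A k (X l)) :
    isStronglyProjInj A k Y := by
  rw [isStronglyProjInj_iff]
  intro i
  induction i generalizing X Y with
  | zero => exact isProj_of_isSummandOfSum h fun l ↦ (hX l).1
  | succ i ih => exact ih (h.map (nakayama k A)) fun l ↦ isStronglyProjInj_nakayama (hX l)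

lemma isStronglyProjInj_of_retract {X Y : FGModuleCat.{u} A} (h : Retract Y X)
    (hX : isStronglyProjInj A k X) : isStronglyProjInj A k Y :=
  isStronglyProjInj_of_isSummandOfSum (isSummandOfSum_of_retract h) fun _ ↦ hX

lemma isStronglyProjInj_of_isZero {X : FGModuleCat.{u} A} (h : IsZero X) :
    isStronglyProjInj A k X :=
  isStronglyProjInj_of_isSummandOfSum (isSummandOfSum_of_isZero h) fun l ↦ l.elim0

lemma isStronglyProjInj_of_add_eq {X₀ X₁ Y : FGModuleCat.{u} A} (b₀ : Y ⟶ X₀) (a₀ : X₀ ⟶ Y)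
    (b₁ : Y ⟶ X₁) (a₁ : X₁ ⟶ Y) (h : b₀ ≫ a₀ + b₁ ≫ a₁ = 𝟙 Y)
    (h₀ : isStronglyProjInj A k X₀) (h₁ : isStronglyProjInj A k X₁) :
    isStronglyProjInj A k Y := by
  refine isStronglyProjInj_of_isSummandOfSum (X := ![X₀, X₁])
    ⟨fun | 0 => b₀ | 1 => b₁, fun | 0 => a₀ | 1 => a₁, ?_⟩ fun | 0 => h₀ | 1 => h₁
  rw [Fin.sum_univ_two]
  exact h

lemma IsIndecomposable.iterate {P : FGModuleCat.{u} A} (h : IsIndecomposable P)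
    (hP : isStronglyProjInj A k P) (i : ℕ) : IsIndecomposable ((nakayama k A).obj^[i] P) := by
  induction i with
  | zero => exact h
  | succ i ih =>
    rw [Function.iterate_succ_apply']
    exact ih.nakayama_obj k (isStronglyProjInj_iff.1 hP i)

lemma nonempty_iso_of_iterate {P Q : FGModuleCat.{u} A} (hP : isStronglyProjInj A k P)
    (hQ : isStronglyProjInj A k Q) (i : ℕ)
    (e : (nakayama k A).obj^[i] P ≅ (nakayama k A).obj^[i] Q) : Nonempty (P ≅ Q) := by
  induction i with
  | zero => exact ⟨e⟩
  | succ i ih =>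
    rw [Function.iterate_succ_apply', Function.iterate_succ_apply'] at e
    obtain ⟨e'⟩ := nonempty_iso_of_nakayama k (isStronglyProjInj_iff.1 hP i)
      (isStronglyProjInj_iff.1 hQ i) e
    exact ih e'

/-- The trace ideals of the tails of the sequence `P, ν P, ν² P, …` form a descending chain of left
ideals of `A`. Where it stabilises, some `νⁱ P` is generated by the `νʲ P` with `j > i`. -/
lemma exists_isSummandOfSum_iterate {P : FGModuleCat.{u} A} (hP : isStronglyProjInj A k P) :
    ∃ (i n : ℕ) (j : Fin n → ℕ), (∀ l, i < j l) ∧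
      IsSummandOfSum (fun l ↦ (nakayama k A).obj^[j l] P) ((nakayama k A).obj^[i] P) := by
  have : IsArtinianRing A := IsArtinianRing.of_finite k A
  let N (i : ℕ) : FGModuleCat.{u} A := (nakayama k A).obj^[i] P
  let T (i : ℕ) : Submodule A A := ⨆ (j : ℕ) (_ : i ≤ j) (f : N j →ₗ[A] A), LinearMap.range f
  obtain ⟨i, hi⟩ := IsArtinian.monotone_stabilizes (R := A) (M := A)
    { toFun := fun i ↦ OrderDual.toDual (T i)
      monotone' := fun i i' h ↦ OrderDual.toDual_le_toDual.2
        (iSup_mono fun j ↦ iSup_mono' fun h' ↦ ⟨h.trans h', le_rfl⟩) }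
  have hT : T i = T (i + 1) := hi (i + 1) (by lia)
  have hproj : Module.Projective A (N i) := isStronglyProjInj_iff.1 hP i
  obtain ⟨n, X, hX, h⟩ := exists_isSummandOfSum (Q := N i) hproj (fun X ↦ ∃ j, i < j ∧ X = N j) (by
    intro U hU
    rw [eq_top_iff]
    intro q _
    obtain ⟨n, f, x, hx⟩ := exists_dual_basis (A := A) (P := N i)
    rw [← hx q]
    refine Submodule.sum_mem _ fun l _ ↦ ?_
    have hmem : f l q ∈ T (i + 1) := by
      rw [← hT]
      exact Submodule.mem_iSup_of_mem i (Submodule.mem_iSup_of_mem le_rfl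
        (Submodule.mem_iSup_of_mem (f l) ⟨q, rfl⟩))
    have hle : T (i + 1) ≤ U.comap (LinearMap.toSpanSingleton A (N i) (x l)) := by
      refine iSup₂_le fun j hj ↦ iSup_le fun g ↦ ?_
      rintro _ ⟨y, rfl⟩
      exact hU (N j) ⟨j, by lia, rfl⟩ (FGModuleCat.ofHom (smulHom g (x l))) ⟨y, rfl⟩
    exact hle hmem)
  choose j hj hXj using hX
  obtain rfl : X = fun l ↦ N (j l) := funext hXj
  exact ⟨i, n, j, hj, h⟩

/-- `ν` permutes the finitely many isomorphism classes of indecomposable strongly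
projective-injective modules. -/
lemma exists_iterate_iso {P : FGModuleCat.{u} A} (hP : isStronglyProjInj A k P)
    (h : IsIndecomposable P) : ∃ n : ℕ, Nonempty ((nakayama k A).obj^[n + 1] P ≅ P) := by
  obtain ⟨i, n, j, hj, hs⟩ := exists_isSummandOfSum_iterate hP
  obtain ⟨l, ⟨r⟩⟩ := exists_retract_of_isSummandOfSum k (h.iterate hP i) hs
  have := (h.iterate hP (j l)).isIso_of_retract (h.iterate hP i) r
  obtain ⟨m, hm⟩ := Nat.exists_eq_add_of_lt (hj l)
  have e := asIso r.i
  rw [hm, add_assoc, Function.iterate_add_apply] at e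
  obtain ⟨e'⟩ := nonempty_iso_of_iterate hP (isStronglyProjInj_iterate hP (m + 1)) i e
  exact ⟨m, ⟨e'.symm⟩⟩

/-- If `νⁿ⁺¹ P ≅ P`, then `P ⊕ ν P ⊕ ⋯ ⊕ νⁿ P` is `ν`-invariant. -/
lemma exists_nakayama_invariant_of_isIndecomposable {P : FGModuleCat.{u} A}
    (hP : isStronglyProjInj A k P) (h : IsIndecomposable P) :
    ∃ W : FGModuleCat.{u} A, isStronglyProjInj A k W ∧
      Nonempty ((nakayama k A).obj W ≅ W) ∧ Nonempty (Retract P W) := by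
  have : IsNoetherianRing A := IsNoetherianRing.of_finite k A
  have := Abelian.hasFiniteBiproducts (C := FGModuleCat.{u} A)
  obtain ⟨n, ⟨e⟩⟩ := exists_iterate_iso hP h
  let N (i : Fin (n + 1)) : FGModuleCat.{u} A := (nakayama k A).obj^[(i : ℕ)] P
  refine ⟨⨁ N, isStronglyProjInj_of_isSummandOfSum (isSummandOfSum_biproduct N)
    fun i ↦ isStronglyProjInj_iterate hP i, ?_,
    ⟨⟨biproduct.ι N 0, biproduct.π N 0, biproduct.ι_π_self N 0⟩⟩⟩
  refine ⟨(nakayama k A).mapBiproduct N ≪≫ biproduct.whiskerEquiv (finRotate (n + 1)) fun i ↦ ?_⟩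
  refine Nonempty.some ?_
  simp only [Function.comp_apply, N, ← Function.iterate_succ_apply']
  by_cases hi : i = Fin.last n
  · subst hi
    rw [finRotate_last]
    exact ⟨e.symm⟩
  · rw [coe_finRotate_of_ne_last hi]
    exact ⟨Iso.refl _⟩

/-- Every strongly projective-injective module is a direct summand of a `ν`-invariant one. -/
lemma exists_nakayama_invariant {P : FGModuleCat.{u} A} (hP : isStronglyProjInj A k P) :
    ∃ W : FGModuleCat.{u} A, isStronglyProjInj A k W ∧
      Nonempty ((nakayama k A).obj W ≅ W) ∧ Nonempty (Retract P W) := by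
  induction hd : kdim k P using Nat.strong_induction_on generalizing P with
  | h d ih =>
    subst hd
    have : IsNoetherianRing A := IsNoetherianRing.of_finite k A
    by_cases h0 : 𝟙 P = 0
    · refine ⟨P, hP, ⟨IsZero.iso (isZero_of_id_eq_zero ?_) (isZero_of_id_eq_zero h0)⟩,
        ⟨Retract.refl P⟩⟩
      rw [← CategoryTheory.Functor.map_id, h0, Functor.map_zero]
    by_cases hind : IsIndecomposable P
    · exact exists_nakayama_invariant_of_isIndecomposable hP hind
    obtain ⟨e, he, he0, he1⟩ : ∃ e : P ⟶ P, e ≫ e = e ∧ e ≠ 0 ∧ e ≠ 𝟙 P := by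
      by_contra! H
      exact hind ⟨h0, fun e he ↦ or_iff_not_imp_left.2 (H e he)⟩
    obtain ⟨Y, i, r, hir, hri⟩ := exists_splitting e he
    obtain ⟨Y', i', r', hir', hri'⟩ := exists_splitting (𝟙 P - e) (by simp [he])
    obtain ⟨W, hW, ⟨w⟩, ⟨s⟩⟩ := ih _ (kdim_lt_of_retract k (M := Y) (N := P) ⟨i, r, hir⟩
      (by rwa [hri])) (isStronglyProjInj_of_retract ⟨i, r, hir⟩ hP) rfl
    obtain ⟨W', hW', ⟨w'⟩, ⟨s'⟩⟩ := ih _ (kdim_lt_of_retract k (M := Y') (N := P) ⟨i', r', hir'⟩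
      (by simpa [hri'] using he0)) (isStronglyProjInj_of_retract ⟨i', r', hir'⟩ hP) rfl
    have := preservesBinaryBiproducts_of_preservesBiproducts (nakayama k A)
    refine ⟨W ⊞ W', ?_, ⟨(nakayama k A).mapBiprod W W' ≪≫ biprod.mapIso w w'⟩,
      ⟨⟨biprod.lift (r ≫ s.i) (r' ≫ s'.i), biprod.desc (s.r ≫ i) (s'.r ≫ i'), ?_⟩⟩⟩
    · exact isStronglyProjInj_of_add_eq biprod.fst biprod.inl biprod.snd biprod.inr biprod.total
        hW hW'
    · simp [hri, hri']

lemma injective_of_isStronglyProjInj {P : FGModuleCat.{u} A} (hP : isStronglyProjInj A k P) :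
    Injective P := by
  obtain ⟨W, hW, ⟨w⟩, ⟨s⟩⟩ := exists_nakayama_invariant hP
  have := injective_nakayama_obj k hW.1
  have : Injective W := Injective.of_iso w inferInstance
  exact s.injective

variable (k) in
/-- The modules `S` with `Hom_A(E, S) = 0` for all strongly projective-injective modules `E`. -/
def IsOrthogonal (S : FGModuleCat.{u} A) : Prop :=
  ∀ E, isStronglyProjInj A k E → ∀ g : E ⟶ S, g = 0

lemma IsOrthogonal.hom_nakayama_eq_zero {S E : FGModuleCat.{u} A} (hS : IsOrthogonal k S)
    (hE : isStronglyProjInj A k E) (h : S ⟶ (nakayama k A).obj E) : h = 0 := by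
  have : Module.Projective A E := hE.1
  ext : 1
  exact NuStable.hom_nakayama_eq_zero k (fun g ↦
    congrArg (fun φ : E ⟶ S ↦ φ.hom.hom) (hS E hE (FGModuleCat.ofHom g))) h.hom.hom

lemma IsOrthogonal.hom_eq_zero {S E : FGModuleCat.{u} A} (hS : IsOrthogonal k S)
    (hE : isStronglyProjInj A k E) (h : S ⟶ E) : h = 0 := by
  obtain ⟨W, hW, ⟨w⟩, ⟨s⟩⟩ := exists_nakayama_invariant hE
  have := hS.hom_nakayama_eq_zero hW (h ≫ s.i ≫ w.inv)
  calc h = (h ≫ s.i ≫ w.inv) ≫ w.hom ≫ s.r := by simp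
    _ = 0 := by rw [this, zero_comp]

lemma exists_injective_linearMap_of_one_le (hA : 1 ≤ nuDominantDimension k A) :
    ∃ (E : FGModuleCat.{u} A) (f : FGModuleCat.of A A ⟶ E), isStronglyProjInj A k E ∧
      Function.Injective f.hom.hom := by
  have : IsNoetherianRing A := IsNoetherianRing.of_finite k A
  obtain ⟨d, ⟨I, -, hI⟩, hd⟩ := lt_sSup_iff.1 (zero_lt_one.trans_le hA)
  have : Mono (I.ι.f 0) := inferInstance
  exact ⟨_, I.ι.f 0, hI 0 hd, injective_of_mono (I.ι.f 0)⟩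

/-- If `A` embeds in a strongly projective-injective module, an orthogonal module has no nonzero
homomorphism to a projective module. -/
lemma IsOrthogonal.hom_proj_eq_zero (hA : 1 ≤ nuDominantDimension k A) {S P : FGModuleCat.{u} A}
    (hS : IsOrthogonal k S) (hP : isProj A P) (h : S ⟶ P) : h = 0 := by
  have : Module.Projective A P := hP
  obtain ⟨E, ι, hE, hι⟩ := exists_injective_linearMap_of_one_le hA
  ext s
  by_contra hs
  obtain ⟨f, hf⟩ := exists_hom_ne_zero_of_projective (A := A) hs
  have := hS.hom_eq_zero hE (h ≫ FGModuleCat.ofHom f ≫ ι)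
  have h0 : ι.hom.hom (f (h.hom.hom s)) = 0 := congrArg (fun φ : S ⟶ E ↦ φ.hom.hom s) this
  exact hf (hι (h0.trans (map_zero _).symm))

/-- A projective module without nonzero homomorphisms to the orthogonal simple modules is generated
by strongly projective-injective modules. -/
lemma isStronglyProjInj_of_forall_orthogonal {Q : FGModuleCat.{u} A} (hQ : isProj A Q)
    (h : ∀ S : FGModuleCat.{u} A, IsSimpleModule A S → IsOrthogonal k S → ∀ g : Q ⟶ S, g = 0) :
    isStronglyProjInj A k Q := by
  obtain ⟨n, X, hX, hs⟩ := exists_isSummandOfSum hQ (isStronglyProjInj A k) (by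
    intro U hU
    by_contra hU'
    obtain ⟨V, hV, hUV⟩ := (eq_top_or_exists_le_coatom U).resolve_left hU'
    have : Module.Finite A (Q ⧸ V) := inferInstance
    let S := FGModuleCat.of A (Q ⧸ V)
    let g : Q ⟶ S := FGModuleCat.ofHom V.mkQ
    have hg : g = 0 := by
      refine h S (isSimpleModule_iff_isCoatom.2 hV) (fun E hE f ↦ ?_) g
      have : Module.Projective A E := hE.1
      obtain ⟨f', hf'⟩ := Module.projective_lifting_property V.mkQ f.hom.hom V.mkQ_surjective
      ext x
      have h1 : V.mkQ (f' x) = f.hom.hom x := LinearMap.congr_fun hf' x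
      refine h1.symm.trans ?_
      exact (Submodule.Quotient.mk_eq_zero V).2 (hUV (hU E hE (FGModuleCat.ofHom f') ⟨x, rfl⟩))
    refine hV.1 (eq_top_iff.2 fun q _ ↦ (Submodule.Quotient.mk_eq_zero V).1 ?_)
    exact congrArg (fun φ : Q ⟶ S ↦ φ.hom.hom q) hg)
  exact isStronglyProjInj_of_isSummandOfSum hs hX

end StronglyProjInj

/-! ### Splitting idempotents of complexes and minimal complexes -/

section Splitting

variable {C : Type u} [Category.{v} C] [Preadditive C]

/-- If each `Y n` is a retract of `K.X n` and the differential of `K` preserves the images of the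
idempotents of `K.X n`, these images form a complex. -/
@[simps]
def retractComplex (K : CochainComplex C ℤ) (Y : ℤ → C) (r : ∀ n, Retract (Y n) (K.X n))
    (h : ∀ n m, (r n).i ≫ K.d n m ≫ (r m).r ≫ (r m).i = (r n).i ≫ K.d n m) :
    CochainComplex C ℤ where
  X := Y
  d n m := (r n).i ≫ K.d n m ≫ (r m).r
  shape n m hnm := by rw [K.shape n m hnm, zero_comp, comp_zero]
  d_comp_d' n m l _ _ := by
    have := h n m
    simp only [Category.assoc]
    rw [reassoc_of% this]
    simp

/-- The inclusion of `retractComplex` into the ambient complex. -/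
@[simps]
def retractComplexι (K : CochainComplex C ℤ) (Y : ℤ → C) (r : ∀ n, Retract (Y n) (K.X n))
    (h : ∀ n m, (r n).i ≫ K.d n m ≫ (r m).r ≫ (r m).i = (r n).i ≫ K.d n m) :
    retractComplex K Y r h ⟶ K where
  f n := (r n).i
  comm' n m _ := by
    change _ = ((r n).i ≫ K.d n m ≫ (r m).r) ≫ (r m).i
    rw [Category.assoc, Category.assoc, h]
    rfl

/-- The degreewise image of an idempotent chain map homotopic to the identity is homotopy
equivalent to the whole complex. -/
lemma exists_iso_of_idempotent {K : CochainComplex C ℤ} (p : K ⟶ K) (hp : Homotopy p (𝟙 K))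
    (Y : ℤ → C) (r : ∀ n, Retract (Y n) (K.X n)) (hr : ∀ n, (r n).r ≫ (r n).i = p.f n) :
    ∃ K' : CochainComplex C ℤ, K'.X = Y ∧ Nonempty
      ((HomotopyCategory.quotient C (.up ℤ)).obj K' ≅
        (HomotopyCategory.quotient C (.up ℤ)).obj K) := by
  have h : ∀ n m, (r n).i ≫ K.d n m ≫ (r m).r ≫ (r m).i = (r n).i ≫ K.d n m := by
    intro n m
    rw [hr, ← p.comm, ← hr, Category.assoc, Retract.retract_assoc]
  have h' : ∀ n m, (r n).r ≫ (r n).i ≫ K.d n m ≫ (r m).r = K.d n m ≫ (r m).r := by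
    intro n m
    have := p.comm n m
    rw [← hr, ← hr] at this
    simp only [Category.assoc] at this
    rw [reassoc_of% this]
    simp
  let ρ : K ⟶ retractComplex K Y r h :=
    { f := fun n ↦ (r n).r
      comm' := fun n m _ ↦ h' n m }
  have h₁ : retractComplexι K Y r h ≫ ρ = 𝟙 _ := by
    ext n
    exact (r n).retract
  have h₂ : ρ ≫ retractComplexι K Y r h = p := by
    ext n
    exact hr n
  exact ⟨_, rfl, ⟨HomotopyCategory.isoOfHomotopyEquiv
    { hom := retractComplexι K Y r h
      inv := ρ
      homotopyHomInvId := Homotopy.ofEq h₁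
      homotopyInvHomId := (Homotopy.ofEq h₂).trans hp }⟩⟩

/-- Gaussian elimination: a homotopy operator `h : Kⁿ⁺¹ ⟶ Kⁿ` with `h d h = h` splits a
contractible summand off `K`. -/
lemma exists_homotopy_idempotent (K : CochainComplex C ℤ) {n m : ℤ} (hnm : n + 1 = m)
    (h : K.X m ⟶ K.X n) (hh : h ≫ K.d n m ≫ h = h) :
    ∃ p : K ⟶ K, p ≫ p = p ∧ Nonempty (Homotopy p (𝟙 K)) ∧ p.f m = 𝟙 _ - h ≫ K.d n m := by
  let s (i j : ℤ) : K.X i ⟶ K.X j :=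
    if H : i = m ∧ j = n then eqToHom (by rw [H.1]) ≫ h ≫ eqToHom (by rw [H.2]) else 0
  have hs : s m n = h := by simp [s]
  have hs0 (i j : ℤ) (H : ¬ (i = m ∧ j = n)) : s i j = 0 := dif_neg H
  let e : K ⟶ K := Homotopy.nullHomotopicMap s
  have he (i : ℤ) : e.f i = K.d i (i + 1) ≫ s (i + 1) i + s i (i - 1) ≫ K.d (i - 1) i := by
    simp only [e, Homotopy.nullHomotopicMap]
    rw [dNext_eq s (show (ComplexShape.up ℤ).Rel i (i + 1) by simp),
      prevD_eq s (show (ComplexShape.up ℤ).Rel (i - 1) i by simp)]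
  have he0 (i : ℤ) (h₁ : i ≠ n) (h₂ : i ≠ m) : e.f i = 0 := by
    rw [he, hs0 _ _ (fun H ↦ h₁ H.2), hs0 _ _ (fun H ↦ h₂ H.1), comp_zero, zero_comp, zero_add]
  have hem : e.f m = h ≫ K.d n m := by
    obtain rfl : n = m - 1 := eq_sub_of_add_eq hnm
    rw [he, hs0 (m + 1) m (fun H ↦ absurd H.1 (by simp)), hs, comp_zero, zero_add]
  have hen : e.f n = K.d n m ≫ h := by
    subst hnm
    rw [he, hs0 n (n - 1) (fun H ↦ absurd H.2 (by simp)), hs, zero_comp, add_zero]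
  have hee : e ≫ e = e := by
    ext i
    by_cases h₁ : i = n
    · subst h₁
      rw [HomologicalComplex.comp_f, hen, Category.assoc, hh]
    by_cases h₂ : i = m
    · subst h₂
      rw [HomologicalComplex.comp_f, hem, Category.assoc, reassoc_of% hh]
    · rw [HomologicalComplex.comp_f, he0 i h₁ h₂, comp_zero]
  refine ⟨𝟙 K - e, by simp [hee], ⟨?_⟩, by simp [hem]⟩
  have H : Homotopy e 0 := Homotopy.nullHomotopy s fun i j hij ↦ hs0 i j fun H ↦ hij (by
    rw [H.1, H.2]
    exact hnm)
  exact (Homotopy.ofEq (by simp)).trans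
    (((Homotopy.refl (𝟙 K - e)).add H.symm).trans (Homotopy.ofEq (by simp)))

end Splitting

section Minimal

variable {A : Type u} [Ring A]

lemma proj_exists_retract {Q : Proj A} (e : Q ⟶ Q) (he : e ≫ e = e) :
    ∃ (Y : Proj A) (r : Retract Y Q), r.r ≫ r.i = e := by
  obtain ⟨Y, i, r, hir, hri⟩ := exists_splitting e.hom (congrArg (fun φ ↦ φ.hom) he)
  have hY : isProj A Y := isProj_of_isSummandOfSum (isSummandOfSum_of_retract ⟨i, r, hir⟩)
    fun _ ↦ Q.property
  exact ⟨⟨Y, hY⟩, ⟨ObjectProperty.homMk i, ObjectProperty.homMk r,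
    ObjectProperty.hom_ext _ hir⟩, ObjectProperty.hom_ext _ hri⟩

/-- A complex of projective modules is minimal if its differentials map into the radical, that is,
if they are annihilated by all homomorphisms to simple modules. -/
def IsMinimalComplex (K : CochainComplex (Proj A) ℤ) : Prop :=
  ∀ (n m : ℤ) (S : FGModuleCat.{u} A), IsSimpleModule A S →
    ∀ g : (K.X m).obj ⟶ S, (K.d n m).hom ≫ g = 0

variable (k : Type u) [Field k] [Algebra k A] [Module.Finite k A]

include k in
/-- If `d : P → Q` is not annihilated by some `g : Q → S` with `S` simple, then `g` factors through
`g ∘ d`, which produces a nonzero `h : Q → P` with `h d h = h`. -/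
lemma exists_outer_inverse_differential {P Q : Proj A} (d : P ⟶ Q) {S : FGModuleCat.{u} A}
    (hS : IsSimpleModule A S) (g : Q.obj ⟶ S) (hg : d.hom ≫ g ≠ 0) :
    ∃ h : Q ⟶ P, h ≫ d ≫ h = h ∧ h ≫ d ≠ 0 := by
  have hsurj : Function.Surjective (d.hom ≫ g).hom.hom := by
    rw [← LinearMap.range_eq_top]
    refine (eq_bot_or_eq_top _).resolve_left fun h0 ↦ hg ?_
    ext : 1
    exact LinearMap.range_eq_bot.1 h0
  have : Module.Projective A Q.obj := Q.property
  obtain ⟨t, ht⟩ := Module.projective_lifting_property _ g.hom.hom hsurj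
  let t' : Q.obj ⟶ P.obj := FGModuleCat.ofHom t
  have ht' : (t' ≫ d.hom) ≫ g = g := by
    ext : 1
    exact ht
  obtain ⟨w, hw, hw'⟩ := exists_outer_inverse_hom k _ g (by
    rintro rfl
    exact hg comp_zero) ht'
  simp only [Category.assoc] at hw'
  refine ⟨ObjectProperty.homMk (w ≫ t'), ObjectProperty.hom_ext _ ?_, fun h0 ↦ hw ?_⟩
  · change (w ≫ t') ≫ d.hom ≫ w ≫ t' = w ≫ t'
    simp only [Category.assoc]
    rw [reassoc_of% hw']
  · have h0' : (w ≫ t') ≫ d.hom = 0 := congrArg (fun φ ↦ φ.hom) h0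
    rw [← hw', ← Category.assoc t', ← Category.assoc w, ← Category.assoc w, h0', zero_comp]

include k in
/-- Every bounded complex of projective modules is homotopy equivalent to a minimal one, within the
same bounds: one of least total dimension. -/
lemma exists_minimal_complex (a b : ℤ) (K : CochainComplex (Proj A) ℤ) [K.IsStrictlyGE a]
    [K.IsStrictlyLE b] :
    ∃ K' : CochainComplex (Proj A) ℤ, IsMinimalComplex K' ∧ K'.IsStrictlyGE a ∧
      K'.IsStrictlyLE b ∧ Nonempty ((HomotopyCategory.quotient _ (.up ℤ)).obj K' ≅
        (HomotopyCategory.quotient _ (.up ℤ)).obj K) := by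
  induction hN : ∑ n ∈ Finset.Icc a b, kdim k (K.X n).obj using Nat.strong_induction_on
    generalizing K with
  | h N ih =>
    subst hN
    by_cases hK : IsMinimalComplex K
    · exact ⟨K, hK, inferInstance, inferInstance, ⟨Iso.refl _⟩⟩
    simp only [IsMinimalComplex, not_forall] at hK
    obtain ⟨n, m, S, hS, g, hg⟩ := hK
    have hnm : n + 1 = m := by
      by_contra hnm
      exact hg (by rw [K.shape n m (by simpa using hnm)]; exact zero_comp)
    obtain ⟨h, hh, h0⟩ := exists_outer_inverse_differential k (K.d n m) hS g hg
    obtain ⟨p, hpp, ⟨hp⟩, hpm⟩ := exists_homotopy_idempotent K hnm h hh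
    choose Y r hr using fun i ↦ proj_exists_retract (p.f i)
      (congrArg (fun φ : K ⟶ K ↦ φ.f i) hpp)
    obtain ⟨K', rfl, ⟨e⟩⟩ := exists_iso_of_idempotent p hp Y r hr
    have hzero (i : ℤ) (hi : IsZero (K.X i)) : IsZero (K'.X i) := by
      rw [IsZero.iff_id_eq_zero, ← (r i).retract, hi.eq_of_tgt (r i).i 0, zero_comp]
    have : K'.IsStrictlyGE a := (CochainComplex.isStrictlyGE_iff _ _).2 fun i hi ↦
      hzero i (K.isZero_of_isStrictlyGE a i hi)
    have : K'.IsStrictlyLE b := (CochainComplex.isStrictlyLE_iff _ _).2 fun i hi ↦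
      hzero i (K.isZero_of_isStrictlyLE b i hi)
    have hm : m ∈ Finset.Icc a b := by
      by_contra hm
      have hz : IsZero (K.X m) := by
        rw [Finset.mem_Icc, not_and_or, not_le, not_le] at hm
        exact hm.elim (fun h ↦ K.isZero_of_isStrictlyGE a m h)
          (fun h ↦ K.isZero_of_isStrictlyLE b m h)
      exact h0 (hz.eq_of_src _ _)
    have hlt : kdim k (K'.X m).obj < kdim k (K.X m).obj := by
      refine kdim_lt_of_retract k ((r m).map (isProj A).ι) fun h1 ↦ h0 ?_
      have h2 : (r m).r ≫ (r m).i = 𝟙 _ := ObjectProperty.hom_ext _ h1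
      rw [hr, hpm] at h2
      simpa using h2
    obtain ⟨K'', hmin, hGE, hLE, ⟨e'⟩⟩ := ih _ (Finset.sum_lt_sum
      (fun i _ ↦ kdim_le_of_retract k ((r i).map (isProj A).ι)) ⟨m, hm, hlt⟩) K' rfl
    exact ⟨K'', hmin, hGE, hLE, ⟨e' ≪≫ e⟩⟩

end Minimal

/-! ### Acyclic complexes with injective terms in low degrees -/

section Acyclic

variable {C : Type u} [Category.{v} C] [Abelian C]

/-- If `a : X₀ ⟶ X₁` has a generalised inverse `h`, then the cycles `ker c` embed in `X₁` as a
direct summand, so that a morphism from `S` to `ker c` factors through `X₁`. -/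
lemma eq_zero_of_exact {X₀ X₁ X₂ X₃ S : C} (a : X₀ ⟶ X₁) (b : X₁ ⟶ X₂) (c : X₂ ⟶ X₃)
    (hab : a ≫ b = 0) (hbc : b ≫ c = 0) (h₁ : (ShortComplex.mk a b hab).Exact)
    (h₂ : (ShortComplex.mk b c hbc).Exact) (h : X₁ ⟶ X₀) (hh : a ≫ h ≫ a = a)
    (hS : ∀ y : S ⟶ X₁, y = 0) (x : S ⟶ X₂) (hx : x ≫ c = 0) : x = 0 := by
  let T := ShortComplex.mk b c hbc
  have : Epi T.toCycles := h₂.epi_toCycles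
  have hz : a ≫ T.toCycles = 0 := by
    rw [← cancel_mono T.iCycles, Category.assoc, T.toCycles_i, zero_comp]
    exact hab
  let φ : ShortComplex.mk a T.toCycles hz ⟶ ShortComplex.mk a b hab :=
    { τ₁ := 𝟙 _
      τ₂ := 𝟙 _
      τ₃ := T.iCycles
      comm₁₂ := by simp
      comm₂₃ := by
        change 𝟙 _ ≫ b = T.toCycles ≫ T.iCycles
        rw [T.toCycles_i, Category.id_comp] }
  have : Epi φ.τ₁ := inferInstanceAs (Epi (𝟙 _))
  have : IsIso φ.τ₂ := inferInstanceAs (IsIso (𝟙 _))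
  have : Mono φ.τ₃ := inferInstanceAs (Mono T.iCycles)
  have hex : (ShortComplex.mk a T.toCycles hz).Exact :=
    (ShortComplex.exact_iff_of_epi_of_isIso_of_mono φ).2 h₁
  have : Epi (ShortComplex.mk a T.toCycles hz).g := h₂.epi_toCycles
  -- `1 - h a` vanishes on the image of `a`, hence descends to a section of `X₁ ⟶ ker c`.
  obtain ⟨σ, hσ⟩ : ∃ σ : T.cycles ⟶ X₁, T.toCycles ≫ σ = 𝟙 X₁ - h ≫ a := by
    refine ⟨hex.gIsCokernel.desc (CokernelCofork.ofπ (𝟙 X₁ - h ≫ a) ?_),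
      hex.gIsCokernel.fac _ WalkingParallelPair.one⟩
    change a ≫ _ = 0
    rw [Preadditive.comp_sub, Category.comp_id, hh, sub_self]
  have hσb : σ ≫ b = T.iCycles := by
    rw [← cancel_epi T.toCycles, reassoc_of% hσ, T.toCycles_i, Preadditive.sub_comp,
      Category.id_comp, Category.assoc, hab, comp_zero, sub_zero]
  rw [← T.liftCycles_i x hx, ← hσb, ← Category.assoc, hS (_ ≫ σ), zero_comp]

/-- In an acyclic bounded below complex `L` whose terms are injective in degrees `< m - 1`, the
cycles in degree `m` are a direct summand of `Lᵐ⁻¹`. Hence an object without nonzero morphisms to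
`Lᵐ⁻¹` has none to these cycles. -/
lemma eq_zero_of_acyclic {L : CochainComplex C ℤ} (hL : L.Acyclic) (a : ℤ) [L.IsStrictlyGE a]
    (m : ℤ) (hinj : ∀ i, i + 1 < m → Injective (L.X i)) {S : C}
    (hS : ∀ y : S ⟶ L.X (m - 1), y = 0) (x : S ⟶ L.X m) (hx : x ≫ L.d m (m + 1) = 0) : x = 0 := by
  have hex (i j l : ℤ) (hij : i + 1 = j) (hjl : j + 1 = l) :
      (ShortComplex.mk (L.d i j) (L.d j l) (L.d_comp_d _ _ _)).Exact := by
    have := hL j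
    rwa [L.exactAt_iff' i j l (by simp; lia) (by simp; lia)] at this
  have hn (n : ℕ) : ∀ i j : ℤ, i + 1 = j → j < m → j ≤ a + n →
      ∃ h : L.X j ⟶ L.X i, L.d i j ≫ h ≫ L.d i j = L.d i j := by
    induction n with
    | zero =>
      intro i j hij _ hja
      refine ⟨0, ?_⟩
      have : IsZero (L.X i) := L.isZero_of_isStrictlyGE a i (by simp at hja; lia)
      exact this.eq_of_src _ _
    | succ n ih =>
      intro i j hij hj hja
      obtain ⟨h, hh⟩ := ih (i - 1) i (by lia) (by lia) (by push_cast at hja; lia)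
      have := hinj i (by lia)
      have hd : L.d (i - 1) i ≫ (𝟙 (L.X i) - h ≫ L.d (i - 1) i) = 0 := by
        rw [Preadditive.comp_sub, Category.comp_id, hh, sub_self]
      have E := hex (i - 1) i j (by lia) hij
      refine ⟨E.descToInjective (𝟙 (L.X i) - h ≫ L.d (i - 1) i) hd, ?_⟩
      have hE := E.comp_descToInjective (𝟙 (L.X i) - h ≫ L.d (i - 1) i) hd
      change L.d i j ≫ _ = _ at hE
      rw [reassoc_of% hE, Preadditive.sub_comp, Category.id_comp, Category.assoc, L.d_comp_d,
        comp_zero, sub_zero]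
  obtain ⟨h, hh⟩ := hn (m - 1 - a).toNat (m - 2) (m - 1) (by lia) (by lia) (by lia)
  exact eq_zero_of_exact _ _ _ _ _ (hex (m - 2) (m - 1) m (by lia) (by lia))
    (hex (m - 1) m (m + 1) (by lia) rfl) h hh hS x hx

lemma acyclic_mappingCone {K L : CochainComplex C ℤ} (f : K ⟶ L) (hf : QuasiIso f) :
    (CochainComplex.mappingCone f).Acyclic := by
  rw [← HomotopyCategory.quotient_obj_mem_subcategoryAcyclic_iff_acyclic]
  refine ((HomotopyCategory.subcategoryAcyclic C).trW_iff_of_distinguished _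
    (HomotopyCategory.mappingCone_triangleh_distinguished f)).1 ?_
  rw [← HomotopyCategory.quasiIso_eq_trW_subcategoryAcyclic]
  exact (HomotopyCategory.quotient_map_mem_quasiIso_iff f).2 hf

/-- An isomorphism in the derived category to a K-injective complex is induced by a
quasi-isomorphism. -/
lemma exists_quasiIso [HasDerivedCategory.{w} C] {K L : CochainComplex C ℤ} [L.IsKInjective]
    (e : DerivedCategory.Qh.obj ((HomotopyCategory.quotient C (.up ℤ)).obj K) ≅
      DerivedCategory.Qh.obj ((HomotopyCategory.quotient C (.up ℤ)).obj L)) :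
    ∃ f : K ⟶ L, QuasiIso f := by
  obtain ⟨g, hg⟩ := (CochainComplex.IsKInjective.Qh_map_bijective _ L).surjective e.hom
  obtain ⟨f, rfl⟩ := (HomotopyCategory.quotient _ _).map_surjective g
  refine ⟨f, ?_⟩
  rw [← DerivedCategory.isIso_Q_map_iff_quasiIso]
  have h : IsIso (DerivedCategory.Qh.map ((HomotopyCategory.quotient C (.up ℤ)).map f)) := by
    rw [hg]
    infer_instance
  exact (NatIso.isIso_map_iff (DerivedCategory.quotientCompQhIso C) f).1 h

end Acyclic

section MappingCone

variable {C : Type u} [Category.{v} C] [Preadditive C] [HasBinaryBiproducts C]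

open CochainComplex.mappingCone in
lemma injective_mappingCone_X {K L : CochainComplex C ℤ} (f : K ⟶ L) (i : ℤ)
    [Injective (K.X (i + 1))] [Injective (L.X i)] :
    Injective ((CochainComplex.mappingCone f).X i) := by
  refine Retract.injective (Y := K.X (i + 1) ⊞ L.X i)
    ⟨biprod.lift ((fst f).1.v i (i + 1) rfl) ((snd f).v i i (add_zero i)),
      biprod.desc ((inl f).v (i + 1) i (by lia)) ((inr f).f i), ?_⟩
  rw [biprod.lift_desc, id_X]

lemma mappingCone_hom_eq_zero {K L : CochainComplex C ℤ} (f : K ⟶ L) (i j : ℤ) (hij : i + 1 = j)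
    {S : C} (hK : ∀ x : S ⟶ K.X j, x = 0) (hL : ∀ x : S ⟶ L.X i, x = 0)
    (x : S ⟶ (CochainComplex.mappingCone f).X i) : x = 0 :=
  CochainComplex.mappingCone.ext_to f i j hij (by rw [hK (x ≫ _), zero_comp])
    (by rw [hL (x ≫ _), zero_comp])

/-- A quasi-isomorphism `K ⟶ L` of bounded below complexes with injective terms in degrees `< m`
has an acyclic cone. If `S` has no nonzero morphisms to `Kᵐ` and `Lᵐ⁻¹`, then it has none to the
cycles of `L` in degree `m`. -/
lemma eq_zero_of_quasiIso {C : Type u} [Category.{v} C] [Abelian C] {K L : CochainComplex C ℤ}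
    (f : K ⟶ L) (hf : QuasiIso f) (a : ℤ) [K.IsStrictlyGE a] [L.IsStrictlyGE a] (m : ℤ)
    (hK : ∀ i < m, Injective (K.X i)) (hL : ∀ i < m, Injective (L.X i)) {S : C}
    (hSK : ∀ y : S ⟶ K.X m, y = 0) (hSL : ∀ y : S ⟶ L.X (m - 1), y = 0)
    (x : S ⟶ L.X m) (hx : x ≫ L.d m (m + 1) = 0) : x = 0 := by
  have : CochainComplex.IsStrictlyGE (CochainComplex.mappingCone f) (a - 1) :=
    CochainComplex.isStrictlyGE_mappingCone f a a _ (by simp) (by simp)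
  have hx0 : x ≫ (CochainComplex.mappingCone.inr f).f m = 0 := by
    refine eq_zero_of_acyclic (acyclic_mappingCone f hf) (a - 1) m (fun i hi ↦ ?_)
      (mappingCone_hom_eq_zero f (m - 1) m (by lia) hSK hSL) _ ?_
    · have := hK (i + 1) hi
      have := hL i (by lia)
      exact injective_mappingCone_X f i
    · rw [Category.assoc, CochainComplex.mappingCone.inr_f_d, reassoc_of% hx, zero_comp]
  simpa using congrArg (· ≫ (CochainComplex.mappingCone.snd f).v m m (add_zero m)) hx0

end MappingCone

/-! ### Minimal `ν`-invariant complexes -/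

section Invariant

variable {k A : Type u} [Field k] [Ring A] [Algebra k A] [Module.Finite k A]

/-- By induction on `m`. If `Kᵐ` had a nonzero homomorphism to an orthogonal simple module `S`,
duality and minimality would produce a nonzero homomorphism from `S` to the cycles of `ν K` in
degree `m`. It cannot exist: the terms of `K` are strongly projective-injective in degrees `< m`, so
`S` has no nonzero homomorphism to `ν Kᵐ⁻¹`, nor to the projective module `Kᵐ`. -/
lemma isStronglyProjInj_X_of_quasiIso [IsNoetherianRing A] (hA : 1 ≤ nuDominantDimension k A)
    {K : CochainComplex (Proj A) ℤ} (hK : IsMinimalComplex K) (a : ℤ) [K.IsStrictlyGE a]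
    (f : (((isProj A).ι).mapHomologicalComplex (.up ℤ)).obj K ⟶
      (((isProj A).ι ⋙ nakayama k A).mapHomologicalComplex (.up ℤ)).obj K)
    (hf : QuasiIso f) (m : ℤ) : isStronglyProjInj A k (K.X m).obj := by
  have hn (n : ℕ) : ∀ m : ℤ, m ≤ a + n → isStronglyProjInj A k (K.X m).obj := by
    induction n using Nat.strong_induction_on with
    | h n ih =>
    intro m hm
    have hlt (i : ℤ) (hi : i < m) : isStronglyProjInj A k (K.X i).obj := by
      by_cases hia : i < a
      · exact isStronglyProjInj_of_isZero
          ((isProj A).ι.map_isZero (K.isZero_of_isStrictlyGE a i hia))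
      · exact ih (i - a).toNat (by lia) i (by lia)
    refine isStronglyProjInj_of_forall_orthogonal (K.X m).property fun S hS hSo g ↦ ?_
    by_contra hg
    have : Module.Projective A (K.X m).obj := (K.X m).property
    obtain ⟨h, hh, hd⟩ := exists_hom_nakayama_ne_zero k (g := g.hom.hom)
      (fun h ↦ hg (FGModuleCat.hom_ext h))
    have hx := eq_zero_of_quasiIso f hf a m
      (fun i hi ↦ injective_of_isStronglyProjInj (hlt i hi))
      (fun i _ ↦ injective_nakayama_obj k (K.X i).property)
      (fun y ↦ hSo.hom_proj_eq_zero hA (K.X m).property y)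
      (fun y ↦ hSo.hom_nakayama_eq_zero (hlt (m - 1) (by lia)) y) (FGModuleCat.ofHom h)
      (FGModuleCat.hom_ext (hd _ (K.d m (m + 1)).hom.hom.hom fun g' ↦
        congrArg (fun φ : (K.X m).obj ⟶ S ↦ φ.hom.hom)
          (hK m (m + 1) S hS (FGModuleCat.ofHom g'))))
    exact hh (congrArg (fun φ : S ⟶ (nakayama k A).obj (K.X m).obj ↦ φ.hom.hom) hx)
  exact hn (m - a).toNat m (by lia)

end Invariant

/-! ### The thick subcategory `K^b(stp A)` -/

lemma exists_minimal_complex_iso (k : Type u) {A : Type u} [Field k] [Ring A] [Algebra k A]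
    [Module.Finite k A] (P : Kb (Proj A)) :
    ∃ K : CochainComplex (Proj A) ℤ,
    IsMinimalComplex K ∧ boundedComplexes _ K ∧
      Nonempty ((HomotopyCategory.quotient _ _).obj K ≅ P.obj) := by
  obtain ⟨P, hP⟩ := P
  obtain ⟨L, rfl⟩ := HomotopyCategory.quotient_obj_surjective P
  obtain ⟨a, b, _, _⟩ := (boundedHomotopy_quotient_obj_iff _).1 hP
  obtain ⟨K, hK, ha, hb, e⟩ := exists_minimal_complex k a b L
  exact ⟨K, hK, ⟨a, b, ha, hb⟩, e⟩

section Stp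

variable {k A : Type u} [Field k] [Ring A] [Algebra k A] [Module.Finite k A]

variable (k A) in
/-- The objects of the homotopy category of `Proj A` isomorphic to a bounded complex with strongly
projective-injective terms. -/
def stpHomotopy : ObjectProperty (HomotopyCategory (Proj A) (.up ℤ)) := fun X ↦
  ∃ K : CochainComplex (Proj A) ℤ, boundedComplexes _ K ∧
    (∀ n, isStronglyProjInj A k (K.X n).obj) ∧
    Nonempty ((HomotopyCategory.quotient _ _).obj K ≅ X)

instance : (stpHomotopy k A).IsClosedUnderIsomorphisms where
  of_iso e := by
    rintro ⟨K, hK, h, ⟨e'⟩⟩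
    exact ⟨K, hK, h, ⟨e' ≪≫ e⟩⟩

instance : (stpHomotopy k A).ContainsZero where
  exists_zero :=
    ⟨(HomotopyCategory.quotient _ _).obj 0, Functor.map_isZero _ (isZero_zero _), 0,
      ⟨0, 0, inferInstance, inferInstance⟩, fun n ↦ isStronglyProjInj_of_isZero
        ((isProj A).ι.map_isZero
          ((HomologicalComplex.eval (Proj A) (.up ℤ) n).map_isZero (isZero_zero _))),
      ⟨Iso.refl _⟩⟩

instance : (stpHomotopy k A).IsStableUnderShift ℤ where
  isStableUnderShiftBy n :=
    { le_shift X := by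
        rintro ⟨K, ⟨a, b, _, _⟩, h, ⟨e⟩⟩
        refine ⟨K⟦n⟧, ⟨a - n, b - n, K.isStrictlyGE_shift a n (a - n) (by lia),
          K.isStrictlyLE_shift b n (b - n) (by lia)⟩, fun i ↦ h (i + n),
          ⟨((HomotopyCategory.quotient _ _).commShiftIso n).app K ≪≫
            (shiftFunctor _ n).mapIso e⟩⟩ }

open CochainComplex.mappingCone in
instance : (stpHomotopy k A).IsTriangulatedClosed₃ where
  ext₃' T hT := by
    rintro ⟨K, hK, hK', ⟨e⟩⟩ ⟨L, hL, hL', ⟨e'⟩⟩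
    obtain ⟨f, hf⟩ := (HomotopyCategory.quotient _ _).map_surjective (e.hom ≫ T.mor₁ ≫ e'.inv)
    refine (stpHomotopy k A).le_isoClosure _ ⟨_, boundedComplexes_mappingCone _ f hK hL, fun n ↦ ?_,
      ⟨Pretriangulated.Triangle.π₃.mapIso (Pretriangulated.isoTriangleOfIso₁₂ _ T
        (HomotopyCategory.mappingCone_triangleh_distinguished f) hT e e' ?_)⟩⟩
    · exact isStronglyProjInj_of_add_eq ((fst f).1.v n (n + 1) rfl).hom
        ((inl f).v (n + 1) n (by lia)).hom ((snd f).v n n (add_zero n)).hom ((inr f).f n).hom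
        (congrArg (·.hom) (id_X f n (n + 1) rfl)) (hK' (n + 1)) (hL' n)
    · change (HomotopyCategory.quotient _ _).map f ≫ e'.hom = e.hom ≫ T.mor₁
      rw [hf]
      simp

instance : (stpHomotopy k A).IsTriangulated where
  toIsTriangulatedClosed₂ := .of_isTriangulatedClosed₃

variable (k A) in
lemma kbStp_eq : kbStp k A = (stpHomotopy k A).inverseImage (boundedHomotopy (Proj A)).ι := by
  ext P
  constructor
  · rintro ⟨⟨Q, hQ⟩, ⟨e⟩⟩
    obtain ⟨L, rfl⟩ := HomotopyCategory.quotient_obj_surjective Q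
    obtain ⟨a, b, _, _⟩ := (boundedHomotopy_quotient_obj_iff _).1 hQ
    exact ⟨((stpι A k).mapHomologicalComplex _).obj L, ⟨a, b,
      inferInstanceAs (CochainComplex.IsStrictlyGE (((stpι A k).mapHomologicalComplex _).obj L) a),
      inferInstanceAs (CochainComplex.IsStrictlyLE (((stpι A k).mapHomologicalComplex _).obj L) b)⟩,
      fun n ↦ (L.X n).property, ⟨(boundedHomotopy (Proj A)).ι.mapIso e⟩⟩
  · rintro ⟨K, ⟨a, b, _, _⟩, h, ⟨e⟩⟩
    let L : CochainComplex (Stp A k) ℤ :=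
      { X := fun n ↦ ⟨K.X n, h n⟩
        d := fun n m ↦ ObjectProperty.homMk (K.d n m)
        shape := fun n m hnm ↦ ObjectProperty.hom_ext _ (K.shape n m hnm)
        d_comp_d' := fun n m l _ _ ↦ ObjectProperty.hom_ext _ (K.d_comp_d n m l) }
    have hX (n : ℤ) (hn : IsZero (K.X n)) : IsZero (L.X n) := by
      rw [IsZero.iff_id_eq_zero] at hn ⊢
      exact ObjectProperty.hom_ext _ hn
    have hL : boundedComplexes _ L :=
      ⟨a, b, (CochainComplex.isStrictlyGE_iff _ _).2 fun n hn ↦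
          hX n (K.isZero_of_isStrictlyGE a n hn),
        (CochainComplex.isStrictlyLE_iff _ _).2 fun n hn ↦
          hX n (K.isZero_of_isStrictlyLE b n hn)⟩
    exact ⟨⟨(HomotopyCategory.quotient _ _).obj L, (boundedHomotopy_quotient_obj_iff _).2 hL⟩,
      ⟨(boundedHomotopy (Proj A)).fullyFaithfulι.preimageIso e⟩⟩

lemma kbStp_isTriangulated : (kbStp k A).IsTriangulated := by
  rw [kbStp_eq]
  infer_instance

/-- A minimal complex that is a retract, up to homotopy, of a complex with strongly
projective-injective terms has strongly projective-injective terms: a homomorphism from one of its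
terms to an orthogonal simple module factors up to homotopy through zero, and by minimality the
homotopy does not contribute. -/
lemma isStronglyProjInj_X_of_retract {K L : CochainComplex (Proj A) ℤ} (hK : IsMinimalComplex K)
    (hL : ∀ n, isStronglyProjInj A k (L.X n).obj)
    (r : Retract ((HomotopyCategory.quotient _ _).obj K) ((HomotopyCategory.quotient _ _).obj L))
    (n : ℤ) : isStronglyProjInj A k (K.X n).obj := by
  obtain ⟨i, hi⟩ := (HomotopyCategory.quotient _ _).map_surjective r.i
  obtain ⟨p, hp⟩ := (HomotopyCategory.quotient _ _).map_surjective r.r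
  have H : Homotopy (i ≫ p) (𝟙 K) := HomotopyCategory.homotopyOfEq _ _ (by
    rw [Functor.map_comp, hi, hp, r.retract, CategoryTheory.Functor.map_id])
  refine isStronglyProjInj_of_forall_orthogonal (K.X n).property fun S hS hSo g ↦ ?_
  have hn := H.comm n
  rw [dNext_eq H.hom (i := n) (i' := n + 1) rfl, prevD_eq H.hom (j := n) (j' := n - 1) (by simp)]
    at hn
  have hn' := congrArg (fun φ : K.X n ⟶ K.X n ↦ φ.hom ≫ g) hn
  have h₁ : (i.f n).hom ≫ (p.f n).hom ≫ g = 0 := by rw [hSo _ (hL n) (_ ≫ g), comp_zero]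
  have h₂ : (K.d n (n + 1)).hom ≫ (H.hom (n + 1) n).hom ≫ g = 0 := hK _ _ S hS _
  have h₃ : (K.d (n - 1) n).hom ≫ g = 0 := hK _ _ S hS _
  have h : (i.f n).hom ≫ (p.f n).hom ≫ g =
      (K.d n (n + 1)).hom ≫ (H.hom (n + 1) n).hom ≫ g +
        (H.hom n (n - 1)).hom ≫ (K.d (n - 1) n).hom ≫ g + g := by
    refine hn'.trans ?_
    change ((K.d n (n + 1)).hom ≫ (H.hom (n + 1) n).hom +
      (H.hom n (n - 1)).hom ≫ (K.d (n - 1) n).hom + 𝟙 _) ≫ g = _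
    simp only [Preadditive.add_comp, Category.assoc, Category.id_comp]
  simpa [h₁, h₂, h₃] using h.symm

lemma kbStp_isStableUnderRetracts : (kbStp k A).IsStableUnderRetracts where
  of_retract {P Q} r hQ := by
    rw [kbStp_eq] at hQ ⊢
    obtain ⟨L, -, hL, ⟨e⟩⟩ := hQ
    obtain ⟨K, hK, hK', ⟨e'⟩⟩ := exists_minimal_complex_iso k P
    refine ⟨K, hK', isStronglyProjInj_X_of_retract hK hL ?_, ⟨e'⟩⟩
    exact ((Retract.ofIso e').trans (r.map (boundedHomotopy (Proj A)).ι)).trans (.ofIso e.symm)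

/-- An isomorphism `P ≅ ν P` in the derived category is induced by a quasi-isomorphism between a
minimal complex and its image under `ν`, since the latter is a bounded complex of injectives. -/
lemma isNuInvariant_le_kbStp (hA : 1 ≤ nuDominantDimension k A) :
    isNuInvariant k A ≤ kbStp k A := by
  have : IsNoetherianRing A := IsNoetherianRing.of_finite k A
  let : HasDerivedCategory (FGModuleCat.{u} A) := HasDerivedCategory.standard _
  intro P hP
  rw [kbStp_eq]
  obtain ⟨e⟩ := hP
  obtain ⟨K, hK, ⟨a, b, _, _⟩, ⟨eK⟩⟩ := exists_minimal_complex_iso k P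
  refine ⟨K, ⟨a, b, inferInstance, inferInstance⟩, ?_, ⟨eK⟩⟩
  let L : CochainComplex (FGModuleCat.{u} A) ℤ :=
    (((isProj A).ι ⋙ nakayama k A).mapHomologicalComplex (.up ℤ)).obj K
  have hinj (n : ℤ) : Injective (L.X n) := injective_nakayama_obj k (K.X n).property
  have : L.IsStrictlyGE a :=
    inferInstanceAs (CochainComplex.IsStrictlyGE
      ((((isProj A).ι ⋙ nakayama k A).mapHomologicalComplex (.up ℤ)).obj K) a)
  have : L.IsKInjective := CochainComplex.isKInjective_of_injective L a
  let E (F : Proj A ⥤ FGModuleCat.{u} A) [F.Additive] :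
      DerivedCategory.Qh.obj ((HomotopyCategory.quotient _ (.up ℤ)).obj
        ((F.mapHomologicalComplex (.up ℤ)).obj K)) ≅
      ((kbToDb (FGModuleCat.{u} A)).obj ((mapKb F).obj P)).obj :=
    (F.mapHomotopyCategory (.up ℤ) ⋙ DerivedCategory.Qh).mapIso eK
  obtain ⟨f, hf⟩ := exists_quasiIso (K := ((isProj A).ι.mapHomologicalComplex (.up ℤ)).obj K)
    (L := L) (E (isProj A).ι ≪≫
      (ObjectProperty.ι _).mapIso e ≪≫ (E ((isProj A).ι ⋙ nakayama k A)).symm)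
  exact isStronglyProjInj_X_of_quasiIso hA hK a f hf

end Stp

/-! ### Dévissage of bounded complexes -/

section Devissage

variable {C : Type u} [Category.{v} C] [Preadditive C] [HasZeroObject C]

variable (C) in
/-- The functor `C ⥤ K^b(C)` sending an object to the complex concentrated in degree `n`. -/
noncomputable def singleKb (n : ℤ) : C ⥤ Kb C :=
  (boundedHomotopy C).lift
    (HomologicalComplex.single C (.up ℤ) n ⋙ HomotopyCategory.quotient C (.up ℤ)) fun _ ↦
      (boundedHomotopy_quotient_obj_iff _).2 ⟨n, n, inferInstance, inferInstance⟩

/-- A triangulated subcategory contains a bounded complex if it contains its terms, viewed as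
complexes concentrated in one degree. By induction on the length: the brutal truncation that drops
the term in the lowest degree is a degreewise split subcomplex whose quotient is that term. -/
lemma quotient_obj_of_single [HasBinaryBiproducts C]
    (S : ObjectProperty (HomotopyCategory C (.up ℤ)))
    [S.IsTriangulated] [S.IsClosedUnderIsomorphisms] (K : CochainComplex C ℤ)
    (hK : boundedComplexes C K)
    (hS : ∀ n, S ((HomotopyCategory.quotient _ _).obj
      ((HomologicalComplex.single C (.up ℤ) n).obj (K.X n)))) :
    S ((HomotopyCategory.quotient _ _).obj K) := by
  obtain ⟨a, b, _, hb⟩ := hK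
  have hN (N : ℕ) : ∀ (a : ℤ) (K : CochainComplex C ℤ) [K.IsStrictlyGE a], b < a + N →
      K.IsStrictlyLE b →
      (∀ n, S ((HomotopyCategory.quotient _ _).obj
        ((HomologicalComplex.single C (.up ℤ) n).obj (K.X n)))) →
      S ((HomotopyCategory.quotient _ _).obj K) := by
    induction N with
    | zero =>
      intro a K _ hN _ _
      refine S.prop_of_isZero (Functor.map_isZero _ ?_)
      rw [IsZero.iff_id_eq_zero]
      ext n
      by_cases hn : n < a
      · exact (K.isZero_of_isStrictlyGE a n hn).eq_of_src _ _
      · exact (K.isZero_of_isStrictlyLE b n (by simp at hN; lia)).eq_of_src _ _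
    | succ N ih =>
      intro a K _ hN _ hS
      have hr (n : ℤ) : ∃ (Y : C) (r : Retract Y (K.X n)),
          r.r ≫ r.i = if n = a then 0 else 𝟙 _ := by
        split_ifs
        · exact ⟨0, ⟨0, 0, (isZero_zero C).eq_of_src _ _⟩, zero_comp⟩
        · exact ⟨K.X n, .refl _, Category.id_comp _⟩
      choose Y r hr using hr
      have hda (n : ℤ) : K.d n a = 0 := by
        by_cases hn : n < a
        · exact (K.isZero_of_isStrictlyGE a n hn).eq_of_src _ _
        · exact K.shape _ _ (by simp; lia)
      have h (n m : ℤ) : (r n).i ≫ K.d n m ≫ (r m).r ≫ (r m).i = (r n).i ≫ K.d n m := by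
        rw [hr]
        split_ifs with hm
        · subst hm
          simp [hda]
        · rw [Category.comp_id]
      have hYa : IsZero (Y a) := by
        rw [IsZero.iff_id_eq_zero]
        have := hr a
        rw [if_pos rfl] at this
        calc 𝟙 (Y a) = (r a).i ≫ ((r a).r ≫ (r a).i) ≫ (r a).r := by simp
          _ = 0 := by rw [this, zero_comp, comp_zero]
      have hY (n : ℤ) (hn : IsZero (K.X n)) : IsZero (Y n) := by
        rw [IsZero.iff_id_eq_zero, ← (r n).retract, hn.eq_of_src (r n).r 0, comp_zero]
      let K' := retractComplex K Y r h
      let π : K ⟶ (HomologicalComplex.single C (.up ℤ) a).obj (K.X a) :=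
        HomologicalComplex.mkHomToSingle (𝟙 _) fun n _ ↦ by rw [hda, zero_comp]
      let T : ShortComplex (CochainComplex C ℤ) :=
        ShortComplex.mk (retractComplexι K Y r h) π
          (HomologicalComplex.to_single_hom_ext (hYa.eq_of_src _ _))
      have σ (n : ℤ) : Nonempty ((T.map (HomologicalComplex.eval C _ n)).Splitting) := by
        by_cases hn : n = a
        · subst hn
          refine ⟨⟨(r n).r, (HomologicalComplex.singleObjXSelf (.up ℤ) n (K.X n)).hom,
            (r n).retract, ?_, ?_⟩⟩
          · simp only [T, π, ShortComplex.map_g, HomologicalComplex.eval_map,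
              HomologicalComplex.mkHomToSingle_f, Category.id_comp]
            exact Iso.hom_inv_id _
          · have h₀ : (r n).r ≫ (r n).i = 0 := (hr n).trans (if_pos rfl)
            have h₁ : π.f n ≫ (HomologicalComplex.singleObjXSelf (.up ℤ) n (K.X n)).hom = 𝟙 _ := by
              simp [π]
            exact (congrArg₂ (· + ·) h₀ h₁).trans (zero_add _)
        · refine ⟨⟨(r n).r, 0, (r n).retract,
            (HomologicalComplex.isZero_single_obj_X (.up ℤ) a (K.X a) n hn).eq_of_src _ _, ?_⟩⟩
          have := hr n
          rw [if_neg hn] at this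
          rw [comp_zero, add_zero]
          exact this
      refine S.ext_of_isTriangulatedClosed₂ _
        ((HomotopyCategory.distinguished_iff_iso_trianglehOfDegreewiseSplit _).2
          ⟨T, fun n ↦ (σ n).some, ⟨Iso.refl _⟩⟩) ?_ (hS a)
      have : CochainComplex.IsStrictlyGE K' (a + 1) := by
        rw [CochainComplex.isStrictlyGE_iff]
        intro n hn
        by_cases hna : n = a
        · subst hna
          exact hYa
        · exact hY n (K.isZero_of_isStrictlyGE a n (by lia))
      refine ih (a + 1) K' (by push_cast at hN; lia) ?_ fun n ↦ ?_
      · rw [CochainComplex.isStrictlyLE_iff]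
        exact fun n hn ↦ hY n (K.isZero_of_isStrictlyLE b n hn)
      · by_cases hn : n = a
        · subst hn
          exact S.prop_of_isZero (Functor.map_isZero _ (Functor.map_isZero _ hYa))
        · have := hr n
          rw [if_neg hn] at this
          exact S.prop_of_iso ((HomotopyCategory.quotient _ _).mapIso
            ((HomologicalComplex.single C (.up ℤ) n).mapIso
              ⟨(r n).r, (r n).i, this, (r n).retract⟩)) (hS n)
  exact hN (b + 1 - a).toNat a K (by lia) hb hS

end Devissage

section Thick

variable {k A : Type u} [Field k] [Ring A] [Algebra k A] [Module.Finite k A]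

lemma isNuInvariant_singleKb_obj {W : FGModuleCat.{u} A} (hW : isProj A W)
    (e : (nakayama k A).obj W ≅ W) (n : ℤ) :
    isNuInvariant k A ((singleKb (Proj A) n).obj ⟨W, hW⟩) := by
  have : IsNoetherianRing A := IsNoetherianRing.of_finite k A
  let : HasDerivedCategory (FGModuleCat.{u} A) := HasDerivedCategory.standard _
  refine ⟨(kbToDb (FGModuleCat.{u} A)).mapIso
    ((boundedHomotopy _).fullyFaithfulι.preimageIso
      ((HomotopyCategory.quotient (FGModuleCat.{u} A) (.up ℤ)).mapIso ?_))⟩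
  exact (HomologicalComplex.singleMapHomologicalComplex (isProj A).ι (.up ℤ) n).app ⟨W, hW⟩ ≪≫
    (HomologicalComplex.single (FGModuleCat.{u} A) (.up ℤ) n).mapIso e.symm ≪≫
    ((HomologicalComplex.singleMapHomologicalComplex ((isProj A).ι ⋙ nakayama k A)
      (.up ℤ) n).app ⟨W, hW⟩).symm

/-- A thick subcategory containing the `ν`-invariant complexes contains each strongly
projective-injective module, placed in any degree, as a retract of a `ν`-invariant one. -/
lemma kbStp_le_of_isThick {S : ObjectProperty (Kb (Proj A))} (hS : IsThick S)
    (h : isNuInvariant k A ≤ S) : kbStp k A ≤ S := by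
  have := hS.1
  have := hS.2
  intro P hP
  rw [kbStp_eq] at hP
  obtain ⟨K, hK, hKs, ⟨e⟩⟩ := hP
  have hT : (S.map (boundedHomotopy (Proj A)).ι).IsTriangulated := inferInstance
  have hK' : S.map (boundedHomotopy (Proj A)).ι ((HomotopyCategory.quotient _ _).obj K) := by
    refine quotient_obj_of_single _ K hK fun n ↦ ?_
    obtain ⟨W, hW, ⟨eW⟩, ⟨r⟩⟩ := exists_nakayama_invariant (hKs n)
    let r' : Retract (K.X n) (⟨W, hW.1⟩ : Proj A) :=
      ⟨ObjectProperty.homMk r.i, ObjectProperty.homMk r.r, ObjectProperty.hom_ext _ r.retract⟩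
    exact ObjectProperty.prop_map_obj S (boundedHomotopy (Proj A)).ι
      (S.prop_of_retract (r'.map (singleKb (Proj A) n))
        (h _ (isNuInvariant_singleKb_obj hW.1 eW n)))
  obtain ⟨Q, hQ, ⟨e'⟩⟩ := hK'
  exact S.prop_of_iso ((boundedHomotopy (Proj A)).fullyFaithfulι.preimageIso (e' ≪≫ e)) hQ

end Thick

end NuStable

theorem mainTheorem10 (k A : Type u) [Field k] [Ring A] [Algebra k A] [Module.Finite k A]
    (hA : 1 ≤ NuStable.nuDominantDimension k A) :
    IsLeast {S : ObjectProperty (NuStable.Kb (NuStable.Proj A)) |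
        NuStable.IsThick S ∧ NuStable.isNuInvariant k A ≤ S}
      (NuStable.kbStp k A) ∧
    ∀ P : NuStable.Kb (NuStable.Proj A), NuStable.isNuInvariant k A P →
      ∃ Q : NuStable.Kb (NuStable.Stp A k),
        Nonempty (P ≅ (NuStable.mapKb (NuStable.stpι A k)).obj Q) := by
  refine ⟨⟨⟨⟨NuStable.kbStp_isTriangulated, NuStable.kbStp_isStableUnderRetracts⟩,
    NuStable.isNuInvariant_le_kbStp hA⟩, fun S hS ↦ NuStable.kbStp_le_of_isThick hS.1 hS.2⟩,
    fun P hP ↦ ?_⟩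
  obtain ⟨Q, ⟨e⟩⟩ := NuStable.isNuInvariant_le_kbStp hA P hP
  exact ⟨Q, ⟨e.symm⟩⟩
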